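/- Let $\mathbb{F}$ be a finite field with $q$ elements and characteristic $p$, let $A=\mathbb{F}[T]$ and $K=\mathbb{F}(T)$, let $K_\infty=\mathbb{F}((T^{-1}))$ be the completion of $K$ at infinity with the absolute value normalized by $|T|=q$, and let $C$ be the completed algebraic closure of $K_\infty$. Let $L\subset C$ be a finite extension of $K_\infty$, and let $\phi$ be a Drinfeld $A$-module of rank $r\ge 2$ over $L$, given by $$\phi_T(X)=TX+g_1X^q+\dots+g_rX^{q^r},\qquad g_1,\dots,g_r\in L,\ g_r\neq 0.$$ Let $\Lambda$ be its period lattice, i.e. the discrete free $A$-submodule of $C$ of rank $r$ such that $e_\Lambda(Tz)=\phi_T(e_\Lambda(z))$ for all $z\in C$, where $e_\Lambda(z)=z\prod_{0\ne\lambda\in\Lambda}(1-z/\lambda)$. Let $\{\lambda_1,\dots,\lambda_r\}$ be a successive minimum basis of $\Lambda$: for each $i$, $\lambda_i$ has minimal absolute value among the elements of $\Lambda\smallsetminus\sum_{j<i}A\lambda_j$. Split it into packets $\mathbf{B}_1,\dots,\mathbf{B}_t$ of vectors of equal absolute value, ordered by that value, strictly increasing from packet to packet, and let $r_\tau=\#\mathbf{B}_\tau\ge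 1$, so that $\sum_\tau r_\tau=r$. Then the field $L(\Lambda)\subset C$ generated by $\Lambda$ over $L$ is a finite extension of $L$, and its residue class degree satisfies $$f(L(\Lambda)|L)\ \le\ \prod_{1\le\tau\le t}(q^{r_\tau}-1)\cdot p^{t-1}.$$ In particular, $$f(L(\Lambda)|L)\ \le\ (q^r-1)\,p^{t-1}\ \le\ (q^r-1)\,p^{r-1},$$ so that, for given $\mathbb{F}$, the residue class degree is bounded in terms of $r$ alone. -/

import Mathlib

open scoped Polynomial NNReal WithZero

noncomputable section

namespace DrinfeldPeriods

/-! ### The field `K_∞ = 𝔽((T⁻¹))` with `|T| = q` -/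

section KInfty

variable (F : Type*) [Field F]

/-- `K_∞`: the completion of `K = 𝔽(T)` at the place at infinity. -/
abbrev KInfty : Type _ := @RatFunc.CompletionAtInfty F _ (Classical.decEq _)

instance : CompleteSpace (KInfty F) := by
  let _ : DecidableEq (RatFunc F) := Classical.decEq _
  let _ : UniformSpace (RatFunc F) := (RatFunc.inftyValued F).toUniformSpace
  exact inferInstanceAs (CompleteSpace (UniformSpace.Completion (RatFunc F)))

/-- `K_∞` as an algebra over `A = 𝔽[T]`, through `A ⊆ K ⊆ K_∞`. -/
instance : Algebra F[X] (KInfty F) :=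
  ((algebraMap (RatFunc F) (KInfty F)).comp (algebraMap F[X] (RatFunc F))).toAlgebra

/-- The element `T` of `K_∞`. -/
def T : KInfty F := algebraMap F[X] (KInfty F) Polynomial.X

theorem v_T : Valued.v (T F) = (WithZero.exp (1 : ℤ) : ℤᵐ⁰) := by
  let _ : DecidableEq (RatFunc F) := Classical.decEq _
  have h : (RatFunc.inftyValued F).v (RatFunc.X : RatFunc F) = (WithZero.exp (1 : ℤ) : ℤᵐ⁰) :=
    RatFunc.inftyValuation.X F
  rw [← h, T]
  have h2 : algebraMap F[X] (KInfty F) Polynomial.X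
      = algebraMap (RatFunc F) (KInfty F) (RatFunc.X) := by
    change algebraMap (RatFunc F) (KInfty F) (algebraMap F[X] (RatFunc F) Polynomial.X) = _
    rw [RatFunc.algebraMap_X]
  rw [h2]
  exact @Valued.extensionValuation_apply_coe (RatFunc F) _ ℤᵐ⁰ _ (RatFunc.inftyValued F) _

variable [Fintype F]

theorem one_lt_card : (1 : ℝ≥0) < (Fintype.card F : ℝ≥0) := by
  exact_mod_cast Fintype.one_lt_card (α := F)

/-- The value `exp n` of the valuation at infinity corresponds to the absolute value `q ^ n`. -/
instance : Valuation.RankOne (Valued.v : Valuation (KInfty F) ℤᵐ⁰) where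
  hom' := (WithZeroMulInt.toNNReal (ne_of_gt (lt_trans zero_lt_one (one_lt_card F)))).comp
    MonoidWithZeroHom.ValueGroup₀.embedding
  strictMono' := (WithZeroMulInt.toNNReal_strictMono (one_lt_card F)).comp
    MonoidWithZeroHom.ValueGroup₀.embedding_strictMono
  exists_val_nontrivial := ⟨T F, by simp [v_T]⟩

instance : NormedField (KInfty F) := Valued.toNormedField (KInfty F) ℤᵐ⁰

instance : IsUltrametricDist (KInfty F) :=
  inferInstanceAs (@IsUltrametricDist (KInfty F)
    (Valued.toNormedField (KInfty F) ℤᵐ⁰).toMetricSpace.toPseudoMetricSpace.toDist)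

/-- The normalization `|T| = q`. -/
theorem norm_T : ‖T F‖ = Fintype.card F := by
  change ((WithZeroMulInt.toNNReal (ne_of_gt (lt_trans zero_lt_one (one_lt_card F)))
    (MonoidWithZeroHom.ValueGroup₀.embedding (Valued.v.restrict (T F))) : ℝ≥0) : ℝ) = _
  rw [Valuation.embedding_restrict, v_T, WithZeroMulInt.toNNReal_neg_apply _ (by simp)]
  simp [WithZero.exp]

instance : NontriviallyNormedField (KInfty F) where
  non_trivial := ⟨T F, by rw [norm_T]; exact_mod_cast Fintype.one_lt_card (α := F)⟩

end KInfty

/-! ### The field `C`, the completed algebraic closure of `K_∞` -/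

section CInfty

variable (F : Type*) [Field F] [Fintype F]

/-- The algebraic closure of `K_∞` with the unique extension of the absolute value. -/
instance : NormedField (AlgebraicClosure (KInfty F)) :=
  spectralNorm.normedField (KInfty F) (AlgebraicClosure (KInfty F))

instance : NormedAlgebra (KInfty F) (AlgebraicClosure (KInfty F)) :=
  spectralNorm.normedAlgebra _ _

instance : UniformContinuousConstSMul (KInfty F) (AlgebraicClosure (KInfty F)) :=
  uniformContinuousConstSMul_of_continuousConstSMul _ _

/-- `C`: the completed algebraic closure of `K_∞`. -/
def CInfty : Type _ := UniformSpace.Completion (AlgebraicClosure (KInfty F))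

instance : NormedField (CInfty F) :=
  inferInstanceAs (NormedField (UniformSpace.Completion (AlgebraicClosure (KInfty F))))

instance : NormedAlgebra (KInfty F) (CInfty F) :=
  inferInstanceAs (NormedAlgebra (KInfty F)
    (UniformSpace.Completion (AlgebraicClosure (KInfty F))))

instance : CompleteSpace (CInfty F) :=
  inferInstanceAs (CompleteSpace (UniformSpace.Completion (AlgebraicClosure (KInfty F))))

instance : IsUltrametricDist (CInfty F) := IsUltrametricDist.of_normedAlgebra (KInfty F)

instance : Algebra F[X] (CInfty F) :=
  ((algebraMap (KInfty F) (CInfty F)).comp (algebraMap F[X] (KInfty F))).toAlgebra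

instance : IsScalarTower F[X] (KInfty F) (CInfty F) :=
  IsScalarTower.of_algebraMap_eq (congrFun rfl)

end CInfty

/-! ### Residue class degrees of subfields of `C` -/

section Residue

variable (F : Type*) [Field F] [Fintype F]

/-- The valuation ring `{x | |x| ≤ 1}` of a field `E` embedded in `C`. -/
def valuationRing (E : Type*) [Field E] [Algebra E (CInfty F)] : ValuationSubring E :=
  (NormedField.valuation (K := CInfty F)).valuationSubring.comap (algebraMap E (CInfty F))

theorem mem_valuationRing {E : Type*} [Field E] [Algebra E (CInfty F)] (x : E) :
    x ∈ valuationRing F E ↔ ‖algebraMap E (CInfty F) x‖ ≤ 1 := by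
  rfl

/-- For `E ⊆ E' ⊆ C`, the inclusion of the valuation rings. -/
@[reducible]
def valuationRingAlgebra (E E' : Type*) [Field E] [Field E'] [Algebra E E']
    [Algebra E (CInfty F)] [Algebra E' (CInfty F)] [IsScalarTower E E' (CInfty F)] :
    Algebra (valuationRing F E) (valuationRing F E') :=
  ((algebraMap E E').restrict (valuationRing F E) (valuationRing F E') (fun x hx => by
    rw [mem_valuationRing] at hx ⊢
    rwa [← IsScalarTower.algebraMap_apply])).toAlgebra

/-- The residue class degree `f(E'|E)`, for `E ⊆ E' ⊆ C`. -/
def residueDegree (E E' : Type*) [Field E] [Field E'] [Algebra E E']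
    [Algebra E (CInfty F)] [Algebra E' (CInfty F)] [IsScalarTower E E' (CInfty F)] : ℕ :=
  letI := valuationRingAlgebra F E E'
  (IsLocalRing.maximalIdeal (valuationRing F E')).inertiaDeg (valuationRing F E)

end Residue

/-! ### Lattices, Drinfeld modules, successive minimum bases -/

section Drinfeld

variable {F : Type*} [Field F] [Fintype F]

/-- An `A`-lattice of rank `r` in `C`: a discrete free `A`-submodule of rank `r`. -/
structure IsLattice (r : ℕ) (Λ : Submodule F[X] (CInfty F)) : Prop where
  discrete : DiscreteTopology Λ
  free : Module.Free F[X] Λ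
  finite : Module.Finite F[X] Λ
  rank_eq : Module.finrank F[X] Λ = r

/-- The exponential function `e_Λ(z) = z ∏_{0 ≠ λ ∈ Λ} (1 - z / λ)`. -/
def latticeExp (Λ : Submodule F[X] (CInfty F)) (z : CInfty F) : CInfty F :=
  z * ∏' l : {l : CInfty F // l ∈ Λ ∧ l ≠ 0}, (1 - z / (l : CInfty F))

/-- A Drinfeld `A`-module of rank `r` over `L`, given by the coefficients of its `T`-operator
polynomial; `coeff i` is the coefficient `g_{i+1}` of `X ^ (q ^ (i + 1))`. -/
structure DrinfeldModule (L : IntermediateField (KInfty F) (CInfty F)) (r : ℕ) where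
  coeff : Fin r → L
  leading_ne_zero : ∀ i : Fin r, (i : ℕ) + 1 = r → coeff i ≠ 0

/-- The `T`-operator polynomial `φ_T(X) = T X + g_1 X^q + ⋯ + g_r X^(q^r)`. -/
def DrinfeldModule.operatorT {L : IntermediateField (KInfty F) (CInfty F)} {r : ℕ}
    (φ : DrinfeldModule L r) : Polynomial L :=
  Polynomial.C (algebraMap (KInfty F) L (T F)) * Polynomial.X +
    ∑ i : Fin r, Polynomial.C (φ.coeff i) * Polynomial.X ^ (Fintype.card F ^ ((i : ℕ) + 1))

/-- `Λ` is the period lattice of the rank-`r` Drinfeld module `φ`. -/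
structure IsPeriodLattice {L : IntermediateField (KInfty F) (CInfty F)} {r : ℕ}
    (φ : DrinfeldModule L r) (Λ : Submodule F[X] (CInfty F)) : Prop where
  isLattice : IsLattice r Λ
  exp_T_mul : ∀ z : CInfty F,
    latticeExp Λ (algebraMap (KInfty F) (CInfty F) (T F) * z) =
      Polynomial.aeval (latticeExp Λ z) φ.operatorT

/-- `lam` is a successive minimum basis of `Λ`: each `lam i` has minimal absolute value among the
elements of `Λ` outside the `A`-span of the preceding ones. -/
structure IsSuccessiveMinimumBasis {r : ℕ} (Λ : Submodule F[X] (CInfty F))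
    (lam : Fin r → CInfty F) : Prop where
  mem : ∀ i, lam i ∈ Λ
  notMem_span : ∀ i, lam i ∉ Submodule.span F[X] (lam '' {j | j < i})
  norm_le : ∀ i, ∀ μ ∈ Λ, μ ∉ Submodule.span F[X] (lam '' {j | j < i}) → ‖lam i‖ ≤ ‖μ‖

/-- `B 0, …, B (t - 1)` are the (index sets of the) packets of vectors of equal length of the
family `lam`, ordered according to that length. -/
structure IsPacketSplitting {r : ℕ} (lam : Fin r → CInfty F) {t : ℕ}
    (B : Fin t → Finset (Fin r)) : Prop where
  nonempty : ∀ τ, (B τ).Nonempty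
  exists_mem : ∀ i, ∃ τ, i ∈ B τ
  norm_eq : ∀ τ, ∀ i ∈ B τ, ∀ j ∈ B τ, ‖lam i‖ = ‖lam j‖
  norm_lt : ∀ τ τ', τ < τ' → ∀ i ∈ B τ, ∀ j ∈ B τ', ‖lam i‖ < ‖lam j‖

/-- The field `L(Λ)` generated over `L` by the period lattice. -/
abbrev periodField (L : IntermediateField (KInfty F) (CInfty F))
    (Λ : Submodule F[X] (CInfty F)) : IntermediateField L (CInfty F) :=
  IntermediateField.adjoin L (Λ : Set (CInfty F))

end Drinfeld

end DrinfeldPeriods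

end

/-! The Galois action on periods is by isometries, and an isometry of `Λ` of finite order has small
order.

Rationality of the periods. Put `N` large and let `M` be the splitting field of the separable
polynomial `φ_{T^N}` over `L`. It contains the division points `e_Λ(λ/T^N)` of a basis. Near 0 the
map `φ_T` is multiplication by `T` plus a contractible error, and `M` is complete, so the further
points `e_Λ(λ/T^m)` are in `M` too, and so is `λ = lim T^m e_Λ(λ/T^m)`. The same approximation shows
that `Gal(M|L)` maps `Λ` to itself (`exists_isGalois_lattice_subset`).

Bounding an order. A successive minimum basis is orthogonal: the norm of a sum is the maximum of the
norms of its terms (`norm_smul_le_norm_sum`). An isometry of `Λ` is therefore block triangular along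
the packets, with diagonal blocks over `F`. A block of size `n` has order at most `q^n - 1`, and
once all blocks are trivial the matrix is unipotent and is killed by `p^(t-1)`
(`exists_pow_eq_one_of_block`).

Conclusion. Lift the Frobenius of the residue extension to `σ` in `Gal(M|L)`
(`exists_frobenius_lift`). Some `σ^n`, with `n` within the bound, fixes `L(Λ)`. With `Q` the order
of the residue field of `L`, the map `x ↦ x^(Q^n)` is then the identity on the residue field of
`L(Λ)`, whose degree is thus at most `n`. -/

noncomputable section

namespace DrinfeldPeriods

open Filter Topology

/-! ### Absolute values of polynomials -/

section PolynomialNorm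

variable {F : Type*} [Field F] [Fintype F] {E : Type*} [NormedField E]

theorem norm_ringHom_C (ψ : F[X] →+* E) {c : F} (hc : c ≠ 0) : ‖ψ (Polynomial.C c)‖ = 1 := by
  have h : (ψ (Polynomial.C c)) ^ (Fintype.card F - 1) = 1 := by
    rw [← map_pow, ← Polynomial.C_pow, FiniteField.pow_card_sub_one_eq_one c hc]; simp
  have hq : Fintype.card F - 1 ≠ 0 := by
    have := Fintype.one_lt_card (α := F); omega
  have h2 : ‖ψ (Polynomial.C c)‖ ^ (Fintype.card F - 1) = 1 := by rw [← norm_pow, h, norm_one]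
  exact (pow_eq_one_iff_of_nonneg (norm_nonneg _) hq).1 h2

theorem norm_ringHom_C_le (ψ : F[X] →+* E) (c : F) : ‖ψ (Polynomial.C c)‖ ≤ 1 := by
  by_cases hc : c = 0
  · simp [hc]
  · exact (norm_ringHom_C ψ hc).le

variable [IsUltrametricDist E]

theorem norm_ringHom_lt_of_degree_lt (ψ : F[X] →+* E) {Q : ℝ} (hQ : 1 < Q)
    (hX : ‖ψ Polynomial.X‖ = Q) {n : ℕ} {a : F[X]} (ha : a.degree < n) : ‖ψ a‖ < Q ^ n := by
  rw [a.as_sum_range_C_mul_X_pow, map_sum]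
  have h0 : (0 : ℝ) < Q ^ n := by positivity
  by_cases ha0 : a = 0
  · simpa [ha0] using h0
  · obtain ⟨i, hi, hle⟩ := IsUltrametricDist.exists_norm_finsetSum_le_of_nonempty
      (Finset.nonempty_range_add_one (n := a.natDegree))
      (fun i => ψ (Polynomial.C (a.coeff i) * Polynomial.X ^ i))
    refine hle.trans_lt ?_
    rw [map_mul, map_pow, norm_mul, norm_pow, hX]
    have hdeg : i < n := by
      have := (Polynomial.natDegree_lt_iff_degree_lt ha0).2 ha
      have := Finset.mem_range.1 hi
      omega
    calc _ ≤ 1 * Q ^ i := by gcongr; exact norm_ringHom_C_le ψ _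
      _ < Q ^ n := by rw [one_mul]; exact pow_lt_pow_right₀ hQ hdeg

theorem norm_ringHom_eq (ψ : F[X] →+* E) {Q : ℝ} (hQ : 1 < Q)
    (hX : ‖ψ Polynomial.X‖ = Q) {a : F[X]} (ha : a ≠ 0) : ‖ψ a‖ = Q ^ a.natDegree := by
  have h1 : ‖ψ (Polynomial.C a.leadingCoeff * Polynomial.X ^ a.natDegree)‖ = Q ^ a.natDegree := by
    rw [map_mul, map_pow, norm_mul, norm_pow, hX,
      norm_ringHom_C ψ (Polynomial.leadingCoeff_ne_zero.2 ha), one_mul]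
  have h2 : ‖ψ a.eraseLead‖ < Q ^ a.natDegree := by
    apply norm_ringHom_lt_of_degree_lt ψ hQ hX
    rw [← Polynomial.degree_eq_natDegree ha]
    exact Polynomial.degree_eraseLead_lt ha
  conv_lhs => rw [← a.eraseLead_add_C_mul_X_pow, map_add]
  rw [IsUltrametricDist.norm_add_eq_max_of_norm_ne_norm (by rw [h1]; exact h2.ne), h1]
  exact max_eq_right h2.le

end PolynomialNorm

theorem denseRange_algebraMap_ratFunc {F : Type*} [Field F] :
    DenseRange (algebraMap (RatFunc F) (KInfty F)) := by
  let _ : DecidableEq (RatFunc F) := Classical.decEq _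
  let _ : UniformSpace (RatFunc F) := (RatFunc.inftyValued F).toUniformSpace
  exact UniformSpace.Completion.denseRange_coe

section

variable {F : Type*} [Field F] [Fintype F]

theorem one_lt_card_real : (1 : ℝ) < Fintype.card F := by
  exact_mod_cast Fintype.one_lt_card (α := F)

theorem norm_algebraMap_KInfty {a : F[X]} (ha : a ≠ 0) :
    ‖algebraMap F[X] (KInfty F) a‖ = (Fintype.card F : ℝ) ^ a.natDegree :=
  norm_ringHom_eq _ one_lt_card_real (norm_T F) ha

theorem norm_algebraMap_X : ‖algebraMap F[X] (CInfty F) Polynomial.X‖ = Fintype.card F := by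
  rw [IsScalarTower.algebraMap_apply F[X] (KInfty F) (CInfty F), norm_algebraMap']
  exact norm_T F

theorem norm_algebraMap_CInfty {a : F[X]} (ha : a ≠ 0) :
    ‖algebraMap F[X] (CInfty F) a‖ = (Fintype.card F : ℝ) ^ a.natDegree :=
  norm_ringHom_eq _ one_lt_card_real norm_algebraMap_X ha

/-- The residue field of `K_∞` is `F`: a rational function close to `c` has a value at infinity,
which is the required constant. -/
theorem exists_norm_sub_C_lt_one {c : KInfty F} (hc : ‖c‖ ≤ 1) :
    ∃ f : F, ‖c - algebraMap F[X] (KInfty F) (Polynomial.C f)‖ < 1 := by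
  obtain ⟨x, hx⟩ := (denseRange_algebraMap_ratFunc (F := F)).exists_dist_lt c one_pos
  rw [dist_eq_norm] at hx
  obtain ⟨a, b, hb, rfl⟩ := IsFractionRing.div_surjective (A := F[X]) x
  have hb0 : b ≠ 0 := nonZeroDivisors.ne_zero hb
  have hmap : algebraMap (RatFunc F) (KInfty F) (algebraMap F[X] _ a / algebraMap F[X] _ b) =
      algebraMap F[X] (KInfty F) a / algebraMap F[X] (KInfty F) b := by
    rw [map_div₀]; rfl
  rw [hmap] at hx
  have hb1 := norm_algebraMap_KInfty hb0
  have hq := one_lt_card_real (F := F)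
  have hbpos : 0 < ‖algebraMap F[X] (KInfty F) b‖ := by rw [hb1]; positivity
  have hbne : algebraMap F[X] (KInfty F) b ≠ 0 := norm_pos_iff.1 hbpos
  have hle : ‖algebraMap F[X] (KInfty F) a / algebraMap F[X] (KInfty F) b‖ ≤ 1 := by
    have := IsUltrametricDist.norm_add_le_max c
      (-(c - algebraMap F[X] (KInfty F) a / algebraMap F[X] (KInfty F) b))
    rw [← sub_eq_add_neg, sub_sub_cancel, norm_neg] at this
    exact this.trans (max_le hc hx.le)
  -- The value of `a/b` at infinity, which is 0 when `deg a < deg b`.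
  refine ⟨a.coeff b.natDegree / b.leadingCoeff, ?_⟩
  set f := a.coeff b.natDegree / b.leadingCoeff with hf
  have hadeg : a.degree ≤ b.natDegree := by
    by_cases ha : a = 0
    · simp [ha]
    rw [norm_div, div_le_one hbpos, hb1, norm_algebraMap_KInfty ha,
      pow_le_pow_iff_right₀ hq] at hle
    exact Polynomial.natDegree_le_iff_degree_le.1 hle
  have hdeg : (a - Polynomial.C f * b).degree < b.natDegree := by
    rw [Polynomial.degree_lt_iff_coeff_zero]
    intro m hm
    rw [Polynomial.coeff_sub, Polynomial.coeff_C_mul]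
    rcases hm.eq_or_lt with rfl | hm
    · rw [hf, Polynomial.coeff_natDegree, div_mul_cancel₀ _ (Polynomial.leadingCoeff_ne_zero.2 hb0),
        sub_self]
    · rw [Polynomial.coeff_eq_zero_of_natDegree_lt hm,
        Polynomial.coeff_eq_zero_of_degree_lt (hadeg.trans_lt (by exact_mod_cast hm))]
      simp
  have h2 : ‖algebraMap F[X] (KInfty F) a / algebraMap F[X] (KInfty F) b -
      algebraMap F[X] (KInfty F) (Polynomial.C f)‖ < 1 := by
    rw [div_sub' hbne, norm_div, div_lt_one hbpos, mul_comm, ← map_mul, ← map_sub, hb1]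
    exact norm_ringHom_lt_of_degree_lt _ hq (norm_T F) hdeg
  rw [← sub_add_sub_cancel]
  exact (IsUltrametricDist.norm_add_le_max _ _).trans_lt (max_lt hx h2)

/-! ### Finite extensions of `K_∞`: residue fields, completeness, invariance of the norm -/

section Finite

variable {E : Type*} [Field E] [Algebra E (CInfty F)]

theorem residue_eq_zero_iff (x : valuationRing F E) :
    IsLocalRing.residue (valuationRing F E) x = 0 ↔ ‖algebraMap E (CInfty F) x‖ < 1 := by
  rw [IsLocalRing.residue_eq_zero_iff, IsLocalRing.mem_maximalIdeal, mem_nonunits_iff]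
  constructor
  · intro h
    refine lt_of_le_of_ne ((mem_valuationRing F _).1 x.2) fun h1 => h ?_
    have hx0 : (x : E) ≠ 0 := by
      rintro h0
      rw [h0] at h1; simp at h1
    have hinv : (x : E)⁻¹ ∈ valuationRing F E := by
      rw [mem_valuationRing, map_inv₀, norm_inv, h1, inv_one]
    exact IsUnit.of_mul_eq_one ⟨_, hinv⟩ (Subtype.ext (mul_inv_cancel₀ hx0))
  · rintro h ⟨u, rfl⟩
    have h1 : (u : valuationRing F E) * ((u⁻¹ : (valuationRing F E)ˣ) : valuationRing F E) = 1 :=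
      u.mul_inv
    have h2 := congrArg (fun y : valuationRing F E => ‖algebraMap E (CInfty F) y‖) h1
    simp only [MulMemClass.coe_mul, map_mul, norm_mul, OneMemClass.coe_one, map_one,
      norm_one] at h2
    have h3 := (mem_valuationRing F _).1 ((u⁻¹ : (valuationRing F E)ˣ) : valuationRing F E).2
    nlinarith [norm_nonneg (algebraMap E (CInfty F) (u : valuationRing F E))]

variable [Algebra (KInfty F) E] [IsScalarTower (KInfty F) E (CInfty F)]

variable (F E) in
/-- The constants, as elements of the valuation ring of an extension of `K_∞`. -/
def constHom : F →+* valuationRing F E :=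
  RingHom.codRestrict
    (((algebraMap (KInfty F) E).comp (algebraMap F[X] (KInfty F))).comp Polynomial.C)
    (valuationRing F E) fun c => by
      rw [mem_valuationRing]
      exact norm_ringHom_C_le ((algebraMap E (CInfty F)).comp
        ((algebraMap (KInfty F) E).comp (algebraMap F[X] (KInfty F)))) c

/-- Lifts of `F`-independent residues are `K_∞`-independent: divide a relation by its largest
coefficient and reduce. So the residue field has `F`-dimension at most `[E : K_∞]`. -/
theorem finite_residueField [FiniteDimensional (KInfty F) E] :
    Finite (IsLocalRing.ResidueField (valuationRing F E)) := by
  let k := IsLocalRing.ResidueField (valuationRing F E)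
  let : Algebra F k := ((IsLocalRing.residue _).comp (constHom F E)).toAlgebra
  have hrank : Module.rank F k ≤ Module.finrank (KInfty F) E := by
    refine rank_le fun s hs => ?_
    choose u hu using IsLocalRing.residue_surjective (R := valuationRing F E)
    have hlin : LinearIndependent (KInfty F) fun i : s => (u i : E) := by
      rw [Fintype.linearIndependent_iff]
      intro g hg
      by_contra! hne
      obtain ⟨i₀, hi₀⟩ := hne
      obtain ⟨j, -, hj⟩ := Finset.exists_max_image Finset.univ (fun i => ‖g i‖)
        ⟨i₀, Finset.mem_univ _⟩
      have hgj : g j ≠ 0 := norm_pos_iff.1 ((norm_pos_iff.2 hi₀).trans_le (hj i₀ (Finset.mem_univ _)))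
      have hle : ∀ i, ‖g i / g j‖ ≤ 1 := fun i => by
        rw [norm_div]; exact div_le_one_of_le₀ (hj i (Finset.mem_univ _)) (norm_nonneg _)
      choose f hf using fun i => exists_norm_sub_C_lt_one (hle i)
      have hsum : ∑ i, (g i / g j) • (u i : E) = 0 := by
        have := congrArg (fun x => (g j)⁻¹ • x) hg
        simpa [Finset.smul_sum, smul_smul, div_eq_inv_mul] using this
      have hzero : ∑ i, f i • (i : k) = 0 := by
        have h1 : ∑ i, f i • (i : k) =
            IsLocalRing.residue _ (∑ i, constHom F E (f i) * u i) := by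
          rw [map_sum]
          refine Finset.sum_congr rfl fun i _ => ?_
          rw [map_mul, hu, Algebra.smul_def]; rfl
        rw [h1, residue_eq_zero_iff]
        have h2 : ((∑ i, constHom F E (f i) * u i : valuationRing F E) : E) =
            - ∑ i, (g i / g j - algebraMap F[X] (KInfty F) (Polynomial.C (f i))) • (u i : E) := by
          simp only [sub_smul, Finset.sum_sub_distrib, hsum, zero_sub, neg_neg]
          push_cast
          refine Finset.sum_congr rfl fun i _ => ?_
          rw [Algebra.smul_def]; rfl
        rw [h2, map_neg, norm_neg, map_sum]
        obtain ⟨i, -, hi⟩ := IsUltrametricDist.exists_norm_finsetSum_le_of_nonempty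
          (t := Finset.univ) ⟨i₀, Finset.mem_univ _⟩ (fun i => algebraMap E (CInfty F)
            ((g i / g j - algebraMap F[X] (KInfty F) (Polynomial.C (f i))) • (u i : E)))
        refine hi.trans_lt ?_
        rw [Algebra.smul_def, map_mul, norm_mul, ← IsScalarTower.algebraMap_apply, norm_algebraMap']
        exact mul_lt_one_of_nonneg_of_lt_one_left (norm_nonneg _) (hf i)
          ((mem_valuationRing F _).1 (u i).2)
      have hfj := Fintype.linearIndependent_iff.1 hs f hzero j
      have := hf j
      rw [hfj, div_self hgj] at this
      simp at this
    simpa using hlin.fintype_card_le_finrank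
  have : Module.Finite F k :=
    Module.rank_lt_aleph0_iff.1 (hrank.trans_lt (Cardinal.natCast_lt_aleph0))
  exact Module.finite_of_finite F

end Finite

theorem isClosed_intermediateField {L : IntermediateField (KInfty F) (CInfty F)}
    [FiniteDimensional (KInfty F) L] (M : IntermediateField L (CInfty F)) [FiniteDimensional L M] :
    IsClosed (M : Set (CInfty F)) := by
  have : FiniteDimensional (KInfty F) M := FiniteDimensional.trans (KInfty F) L M
  have : FiniteDimensional (KInfty F) (M.restrictScalars (KInfty F)).toSubmodule := this
  exact Submodule.closed_of_finiteDimensional (M.restrictScalars (KInfty F)).toSubmodule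

/-- `K_∞` is complete, so the norm on `M` is the spectral norm, which depends only on minimal
polynomials. -/
theorem norm_algEquiv {L : IntermediateField (KInfty F) (CInfty F)}
    [FiniteDimensional (KInfty F) L] (M : IntermediateField L (CInfty F)) [FiniteDimensional L M]
    (σ : M ≃ₐ[L] M) (x : M) : ‖(σ x : CInfty F)‖ = ‖(x : CInfty F)‖ := by
  have : FiniteDimensional (KInfty F) M := FiniteDimensional.trans (KInfty F) L M
  have key : ∀ y : M, ‖(y : CInfty F)‖ = spectralNorm (KInfty F) M y := fun y =>
    spectralNorm_unique_field_norm_ext (K := KInfty F) (L := M)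
      (f := (NormedField.toAbsoluteValue (CInfty F)).comp (algebraMap M (CInfty F)).injective)
      (fun x => norm_algebraMap' (CInfty F) x) y
  rw [key, key]
  exact (spectralNorm_eq_of_equiv (σ.restrictScalars (KInfty F)) x).symm

end

theorem norm_sum_lt_of_forall_lt {E ι : Type*} [SeminormedAddCommGroup E] [IsUltrametricDist E]
    {s : Finset ι} {f : ι → E} {M : ℝ} (hM : 0 < M) (h : ∀ i ∈ s, ‖f i‖ < M) :
    ‖∑ i ∈ s, f i‖ < M := by
  rcases s.eq_empty_or_nonempty with rfl | hs
  · simpa using hM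
  · obtain ⟨i, hi, hle⟩ := IsUltrametricDist.exists_norm_finsetSum_le_of_nonempty hs f
    exact hle.trans_lt (h i hi)

/-! ### Orthogonality of successive minimum bases -/

section SuccessiveMinima

variable {F : Type*} [Field F] [Fintype F]

theorem norm_polynomial_smul (a : F[X]) (x : CInfty F) :
    ‖a • x‖ = ‖algebraMap F[X] (CInfty F) a‖ * ‖x‖ := by
  rw [Algebra.smul_def, norm_mul]

theorem norm_polynomial_smul_of_ne_zero {a : F[X]} (ha : a ≠ 0) (x : CInfty F) :
    ‖a • x‖ = (Fintype.card F : ℝ) ^ a.natDegree * ‖x‖ := by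
  rw [norm_polynomial_smul, norm_algebraMap_CInfty ha]

theorem norm_polynomial_smul_lt {a b : F[X]} (hab : a.degree < b.degree) {x : CInfty F}
    (hx : x ≠ 0) : ‖a • x‖ < ‖b • x‖ := by
  have hb : b ≠ 0 := by rintro rfl; simp at hab
  rw [norm_polynomial_smul, norm_polynomial_smul, norm_algebraMap_CInfty hb]
  refine mul_lt_mul_of_pos_right ?_ (norm_pos_iff.2 hx)
  refine norm_ringHom_lt_of_degree_lt _ one_lt_card_real norm_algebraMap_X ?_
  rwa [← Polynomial.degree_eq_natDegree hb]

namespace IsSuccessiveMinimumBasis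

variable {r : ℕ} {Λ : Submodule F[X] (CInfty F)} {lam : Fin r → CInfty F}

theorem ne_zero (h : IsSuccessiveMinimumBasis Λ lam) (i : Fin r) : lam i ≠ 0 := fun h0 =>
  h.notMem_span i (h0 ▸ Submodule.zero_mem _)

theorem norm_mono (h : IsSuccessiveMinimumBasis Λ lam) {i j : Fin r} (hij : i ≤ j) :
    ‖lam i‖ ≤ ‖lam j‖ := by
  refine h.norm_le i _ (h.mem j) fun hmem => h.notMem_span j ?_
  exact Submodule.span_mono (Set.image_mono fun k hk => lt_of_lt_of_le hk hij) hmem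

/-- If the terms of maximal norm cancelled, so would their leading terms. Dividing these by the
power of `T` belonging to the last index `k` would give a lattice vector shorter than `lam k` in
which `lam k` has a constant coefficient, against the minimality of `lam k`. -/
theorem norm_smul_le_norm_sum (h : IsSuccessiveMinimumBasis Λ lam) (a : Fin r → F[X])
    (i : Fin r) : ‖a i • lam i‖ ≤ ‖∑ j, a j • lam j‖ := by
  by_contra! hlt
  obtain ⟨m, -, hm⟩ := Finset.exists_max_image Finset.univ (fun j => ‖a j • lam j‖)
    ⟨i, Finset.mem_univ i⟩
  set M := ‖a m • lam m‖ with hM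
  have hMlt : ‖∑ j, a j • lam j‖ < M := hlt.trans_le (hm i (Finset.mem_univ i))
  have hMpos : 0 < M := (norm_nonneg _).trans_lt hMlt
  set S := Finset.univ.filter fun j => ‖a j • lam j‖ = M with hS
  have hSne : S.Nonempty := ⟨m, by simp [hS, hM]⟩
  have hS_mem : ∀ {j}, j ∈ S ↔ ‖a j • lam j‖ = M := by simp [hS]
  have ha : ∀ j ∈ S, a j ≠ 0 := fun j hj h0 => by
    rw [hS_mem, h0, zero_smul, norm_zero] at hj
    exact hMpos.ne hj
  set k := S.max' hSne
  have hk : k ∈ S := S.max'_mem hSne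
  -- All terms indexed by `S` have norm `M` and `lam k` is the longest vector among them, so `a k`
  -- has the least degree and the division below is exact.
  have hdeg : ∀ j ∈ S, (a k).natDegree ≤ (a j).natDegree := fun j hj => by
    have h1 := hS_mem.1 hj
    have h2 := hS_mem.1 hk
    rw [norm_polynomial_smul_of_ne_zero (ha j hj)] at h1
    rw [norm_polynomial_smul_of_ne_zero (ha k hk), ← h1] at h2
    have h3 := h.norm_mono (S.le_max' j hj)
    have hpos := norm_pos_iff.2 (h.ne_zero j)
    refine (pow_le_pow_iff_right₀ (one_lt_card_real (F := F))).1 ?_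
    refine le_of_mul_le_mul_right ?_ hpos
    calc _ ≤ (Fintype.card F : ℝ) ^ (a k).natDegree * ‖lam k‖ := by gcongr
      _ = _ := h2
  set b : Fin r → F[X] := fun j => Polynomial.C (a j).leadingCoeff *
    Polynomial.X ^ ((a j).natDegree - (a k).natDegree) with hb
  set μ := ∑ j ∈ S, b j • lam j with hμ
  have hXμ : (Polynomial.X ^ (a k).natDegree : F[X]) • μ =
      ∑ j, a j • lam j - ∑ j ∈ Sᶜ, a j • lam j - ∑ j ∈ S, (a j).eraseLead • lam j := by
    rw [← Finset.sum_add_sum_compl S, add_sub_cancel_right, ← Finset.sum_sub_distrib, hμ,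
      Finset.smul_sum]
    refine Finset.sum_congr rfl fun j hj => ?_
    rw [smul_smul, ← sub_smul]
    congr 1
    rw [hb, eq_sub_iff_add_eq, mul_left_comm, ← pow_add, Nat.add_sub_cancel' (hdeg j hj), add_comm]
    exact (a j).eraseLead_add_C_mul_X_pow
  have hlt1 : ‖∑ j ∈ Sᶜ, a j • lam j‖ < M := norm_sum_lt_of_forall_lt hMpos fun j hj =>
    lt_of_le_of_ne (hm j (Finset.mem_univ j)) fun he => Finset.mem_compl.1 hj (hS_mem.2 he)
  have hlt2 : ‖∑ j ∈ S, (a j).eraseLead • lam j‖ < M := norm_sum_lt_of_forall_lt hMpos fun j hj =>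
    (norm_polynomial_smul_lt (Polynomial.degree_eraseLead_lt (ha j hj)) (h.ne_zero j)).trans_eq
      (hS_mem.1 hj)
  have hlt3 : ‖(Polynomial.X ^ (a k).natDegree : F[X]) • μ‖ < M := by
    rw [hXμ, sub_eq_add_neg, sub_eq_add_neg]
    refine (IsUltrametricDist.norm_add_le_max _ _).trans_lt (max_lt ?_ (by rwa [norm_neg]))
    exact (IsUltrametricDist.norm_add_le_max _ _).trans_lt (max_lt hMlt (by rwa [norm_neg]))
  have hμlt : ‖μ‖ < ‖lam k‖ := by
    rw [← hS_mem.1 hk, norm_polynomial_smul_of_ne_zero (ha k hk),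
      norm_polynomial_smul_of_ne_zero (pow_ne_zero _ Polynomial.X_ne_zero),
      Polynomial.natDegree_X_pow] at hlt3
    exact lt_of_mul_lt_mul_left hlt3 (by positivity)
  have hμΛ : μ ∈ Λ := Submodule.sum_mem _ fun j _ => Submodule.smul_mem _ _ (h.mem j)
  refine hμlt.not_ge (h.norm_le k μ hμΛ fun hspan => h.notMem_span k ?_)
  rw [hμ, ← Finset.add_sum_erase S _ hk] at hspan
  have h1 : ∑ j ∈ S.erase k, b j • lam j ∈ Submodule.span F[X] (lam '' {j | j < k}) := by
    refine Submodule.sum_mem _ fun j hj => Submodule.smul_mem _ _ (Submodule.subset_span ?_)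
    refine ⟨j, ?_, rfl⟩
    exact lt_of_le_of_ne (S.le_max' j (Finset.mem_of_mem_erase hj)) (Finset.ne_of_mem_erase hj)
  have h2 := (Submodule.add_mem_iff_left _ h1).1 hspan
  have h3 := Submodule.smul_mem _ (Polynomial.C (a k).leadingCoeff⁻¹) h2
  have hbk : b k = Polynomial.C (a k).leadingCoeff * Polynomial.X ^
    ((a k).natDegree - (a k).natDegree) := rfl
  rwa [hbk, smul_smul, Nat.sub_self, pow_zero, mul_one, ← Polynomial.C_mul,
    inv_mul_cancel₀ (Polynomial.leadingCoeff_ne_zero.2 (ha k hk)), Polynomial.C_1, one_smul] at h3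

theorem linearIndependent (h : IsSuccessiveMinimumBasis Λ lam) : LinearIndependent F[X] lam := by
  rw [Fintype.linearIndependent_iff]
  intro g hg i
  have h1 := h.norm_smul_le_norm_sum g i
  rw [hg, norm_zero] at h1
  by_contra h0
  rw [norm_polynomial_smul_of_ne_zero h0] at h1
  have := norm_pos_iff.2 (h.ne_zero i)
  have hq := one_lt_card_real (F := F)
  have : 0 < (Fintype.card F : ℝ) ^ (g i).natDegree * ‖lam i‖ := by positivity
  linarith

theorem exists_smul_eq_sum (h : IsSuccessiveMinimumBasis Λ lam) (hΛ : IsLattice r Λ)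
    {μ : CInfty F} (hμ : μ ∈ Λ) :
    ∃ a : F[X], a ≠ 0 ∧ ∃ b : Fin r → F[X], a • μ = ∑ i, b i • lam i := by
  have := hΛ.finite
  let v : Fin (r + 1) → Λ := Fin.cons ⟨μ, hμ⟩ fun i => ⟨lam i, h.mem i⟩
  have hv : ¬ LinearIndependent F[X] v := fun hv => by
    have := hv.fintype_card_le_finrank
    rw [hΛ.rank_eq, Fintype.card_fin] at this
    omega
  obtain ⟨g, hg, i, hi⟩ := Fintype.not_linearIndependent_iff.1 hv
  have hg' := congrArg (Λ.subtype) hg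
  rw [map_sum, Fin.sum_univ_succ] at hg'
  simp only [v, Fin.cons_zero, Fin.cons_succ, map_smul, Submodule.subtype_apply, map_zero] at hg'
  refine ⟨g 0, fun h0 => hi ?_, fun i => - g i.succ, ?_⟩
  · rw [h0, zero_smul, zero_add] at hg'
    have := Fintype.linearIndependent_iff.1 h.linearIndependent _ hg'
    cases i using Fin.cases with
    | zero => exact h0
    | succ i => exact this i
  · simp only [neg_smul, Finset.sum_neg_distrib]
    exact eq_neg_of_add_eq_zero_left hg'

/-- Divide with remainder in `a • μ = ∑ b i • lam i`. The remainders define `ν ∈ Λ` shorter than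
`lam k`, where `k` is the last index with nonzero remainder. Minimality puts `ν` in the span of the
earlier vectors, contradicting linear independence. -/
theorem span_eq (h : IsSuccessiveMinimumBasis Λ lam) (hΛ : IsLattice r Λ) :
    Submodule.span F[X] (Set.range lam) = Λ := by
  classical
  refine le_antisymm (Submodule.span_le.2 (Set.range_subset_iff.2 h.mem)) fun μ hμ => ?_
  obtain ⟨a, ha, b, hab⟩ := h.exists_smul_eq_sum hΛ hμ
  have hspan : ∀ c : Fin r → F[X], ∑ i, c i • lam i ∈ Submodule.span F[X] (Set.range lam) :=
    fun c => Submodule.sum_mem _ fun i _ =>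
      Submodule.smul_mem _ _ (Submodule.subset_span ⟨i, rfl⟩)
  set ν := μ - ∑ i, (b i / a) • lam i with hν
  have haν : a • ν = ∑ i, (b i % a) • lam i := by
    rw [hν, smul_sub, hab, Finset.smul_sum, ← Finset.sum_sub_distrib]
    refine Finset.sum_congr rfl fun i _ => ?_
    rw [smul_smul, ← sub_smul]
    congr 1
    rw [sub_eq_iff_eq_add', EuclideanDomain.div_add_mod]
  suffices hν0 : ν = 0 by
    rw [sub_eq_zero.1 (hν.symm.trans hν0)]
    exact hspan _
  have hνΛ : ν ∈ Λ := Submodule.sub_mem _ hμ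
    (Submodule.sum_mem _ fun j _ => Submodule.smul_mem _ _ (h.mem j))
  by_contra hν0
  set S := Finset.univ.filter fun j => b j % a ≠ 0 with hS
  have haνS : a • ν = ∑ i ∈ S, (b i % a) • lam i := by
    rw [haν, hS, Finset.sum_filter_of_ne]
    intro i _ hi h0
    exact hi (by rw [h0, zero_smul])
  have hSne : S.Nonempty := by
    by_contra hne
    rw [Finset.not_nonempty_iff_eq_empty] at hne
    rw [hne, Finset.sum_empty] at haνS
    have := congrArg norm haνS
    rw [norm_polynomial_smul_of_ne_zero ha, norm_zero] at this
    have := norm_pos_iff.2 hν0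
    have hq := one_lt_card_real (F := F)
    have : 0 < (Fintype.card F : ℝ) ^ a.natDegree * ‖ν‖ := by positivity
    linarith
  set k := S.max' hSne
  have hk : k ∈ S := S.max'_mem hSne
  have hak : ‖a • ν‖ < ‖a • lam k‖ := by
    rw [haνS]
    have hq := one_lt_card_real (F := F)
    refine norm_sum_lt_of_forall_lt ?_ fun i hi => ?_
    · rw [norm_polynomial_smul_of_ne_zero ha]
      have := norm_pos_iff.2 (h.ne_zero k)
      positivity
    · refine (norm_polynomial_smul_lt (EuclideanDomain.mod_lt (b i) ha) (h.ne_zero i)).trans_le ?_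
      rw [norm_polynomial_smul, norm_polynomial_smul]
      gcongr
      exact h.norm_mono (S.le_max' i hi)
  rw [norm_polynomial_smul, norm_polynomial_smul] at hak
  have hνk : ‖ν‖ < ‖lam k‖ := lt_of_mul_lt_mul_left hak (norm_nonneg _)
  have hmem : ν ∈ Submodule.span F[X] (lam '' {j | j < k}) := by
    by_contra hnot
    exact hνk.not_ge (h.norm_le k ν hνΛ hnot)
  have hmem' := Submodule.smul_mem _ a hmem
  rw [haνS, ← Finset.add_sum_erase S _ hk] at hmem'
  have h1 : ∑ j ∈ S.erase k, (b j % a) • lam j ∈ Submodule.span F[X] (lam '' {j | j < k}) := by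
    refine Submodule.sum_mem _ fun j hj => Submodule.smul_mem _ _ (Submodule.subset_span ?_)
    exact ⟨j, lt_of_le_of_ne (S.le_max' j (Finset.mem_of_mem_erase hj))
      (Finset.ne_of_mem_erase hj), rfl⟩
  have h2 := (Submodule.add_mem_iff_left _ h1).1 hmem'
  refine (Finset.mem_filter.1 hk).2 (linearIndependent_iff_eq_zero_of_smul_mem_span.1
    h.linearIndependent k _ (Submodule.span_mono (Set.image_mono ?_) h2))
  exact fun j hj => ⟨Set.mem_univ j, (ne_of_lt hj : j ≠ k)⟩

theorem exists_eq_sum (h : IsSuccessiveMinimumBasis Λ lam) (hΛ : IsLattice r Λ)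
    {μ : CInfty F} (hμ : μ ∈ Λ) : ∃ a : Fin r → F[X], μ = ∑ i, a i • lam i := by
  rw [← h.span_eq hΛ, Submodule.mem_span_range_iff_exists_fun] at hμ
  obtain ⟨a, ha⟩ := hμ
  exact ⟨a, ha.symm⟩

/-- By orthogonality a bound on the vector bounds the degree of each coordinate, and `F` is finite.
-/
theorem finite_norm_le (h : IsSuccessiveMinimumBasis Λ lam) (hΛ : IsLattice r Λ) (R : ℝ) :
    {l | l ∈ Λ ∧ ‖l‖ ≤ R}.Finite := by
  have hq := one_lt_card_real (F := F)
  have hfin : ∀ i, {a : F[X] | ‖a • lam i‖ ≤ R}.Finite := fun i => by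
    have hpos := norm_pos_iff.2 (h.ne_zero i)
    obtain ⟨n, hn⟩ := pow_unbounded_of_one_lt (R / ‖lam i‖) hq
    have : Finite (Polynomial.degreeLT F n) :=
      Finite.of_equiv _ (Polynomial.degreeLTEquiv F n).symm.toEquiv
    refine (Set.toFinite (Polynomial.degreeLT F n : Set F[X])).subset fun a ha => ?_
    rw [SetLike.mem_coe, Polynomial.mem_degreeLT]
    by_cases ha0 : a = 0
    · simp [ha0]
    · rw [Set.mem_ofPred_eq, norm_polynomial_smul_of_ne_zero ha0, ← le_div_iff₀ hpos] at ha
      exact (Polynomial.natDegree_lt_iff_degree_lt ha0).1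
        ((pow_lt_pow_iff_right₀ hq).1 (ha.trans_lt hn))
  refine ((Set.Finite.pi' hfin).image fun a => ∑ i, a i • lam i).subset ?_
  rintro l ⟨hl, hlR⟩
  obtain ⟨a, rfl⟩ := h.exists_eq_sum hΛ hl
  exact ⟨a, fun i => (h.norm_smul_le_norm_sum a i).trans hlR, rfl⟩

theorem norm_zero_le [NeZero r] (h : IsSuccessiveMinimumBasis Λ lam) {l : CInfty F} (hl : l ∈ Λ)
    (hl0 : l ≠ 0) : ‖lam 0‖ ≤ ‖l‖ := by
  refine h.norm_le 0 l hl ?_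
  simpa using hl0

end IsSuccessiveMinimumBasis

end SuccessiveMinima

/-! ### Ultrametric infinite products -/

section InfiniteProduct

variable {E ι : Type*} [NormedField E] [IsUltrametricDist E]

theorem norm_prod_sub_one_le {s : Finset ι} {f : ι → E} {δ : ℝ} (h0 : 0 ≤ δ) (h1 : δ ≤ 1)
    (h : ∀ i ∈ s, ‖f i - 1‖ ≤ δ) : ‖∏ i ∈ s, f i - 1‖ ≤ δ := by
  classical
  induction s using Finset.induction_on with
  | empty => simpa using h0
  | insert a s ha ih =>
    rw [Finset.prod_insert ha]
    have hP := ih fun i hi => h i (Finset.mem_insert_of_mem hi)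
    have hP1 : ‖∏ i ∈ s, f i‖ ≤ 1 := by
      have := IsUltrametricDist.norm_add_le_max (∏ i ∈ s, f i - 1) 1
      rw [sub_add_cancel, norm_one] at this
      exact this.trans (max_le (hP.trans h1) le_rfl)
    have : f a * ∏ i ∈ s, f i - 1 = (f a - 1) * ∏ i ∈ s, f i + (∏ i ∈ s, f i - 1) := by ring
    rw [this]
    refine (IsUltrametricDist.norm_add_le_max _ _).trans (max_le ?_ hP)
    rw [norm_mul]
    exact (mul_le_of_le_one_right (norm_nonneg _) hP1).trans (h a (Finset.mem_insert_self a s))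

/-- The error is relative to the partial product, so it also detects when the full product vanishes.
-/
theorem norm_prod_sub_prod_le {s t : Finset ι} (hst : s ⊆ t) {f : ι → E} {δ : ℝ} (h0 : 0 ≤ δ)
    (h1 : δ ≤ 1) (h : ∀ i ∉ s, ‖f i - 1‖ ≤ δ) :
    ‖∏ i ∈ t, f i - ∏ i ∈ s, f i‖ ≤ δ * ‖∏ i ∈ s, f i‖ := by
  classical
  have := norm_prod_sub_one_le (s := t \ s) h0 h1 fun i hi => h i (Finset.mem_sdiff.1 hi).2
  rw [← Finset.prod_sdiff hst, ← sub_one_mul, norm_mul]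
  gcongr

theorem norm_tprod_sub_prod_le {s : Finset ι} {f : ι → E} (hf : Multipliable f) {δ : ℝ}
    (h0 : 0 ≤ δ) (h1 : δ ≤ 1) (h : ∀ i ∉ s, ‖f i - 1‖ ≤ δ) :
    ‖∏' i, f i - ∏ i ∈ s, f i‖ ≤ δ * ‖∏ i ∈ s, f i‖ := by
  have ht : Tendsto (fun t : Finset ι => ‖∏ i ∈ t, f i - ∏ i ∈ s, f i‖) atTop
      (𝓝 ‖∏' i, f i - ∏ i ∈ s, f i‖) := ((hf.hasProd).sub_const _).norm
  exact le_of_tendsto ht ((eventually_ge_atTop s).mono fun t hst =>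
    norm_prod_sub_prod_le hst h0 h1 h)

theorem multipliable_of_forall_finite [CompleteSpace E] {f : ι → E}
    (h : ∀ δ > 0, {i | δ < ‖f i - 1‖}.Finite) : Multipliable f := by
  classical
  have hc : CauchySeq fun s : Finset ι => ∏ i ∈ s, f i := by
    rw [Metric.cauchySeq_iff']
    intro ε hε
    -- Factors outside `s₁` have norm at most 1, so `P` bounds every larger partial product. The `P
    -- + 1` in `δ` covers the case `P = 0`.
    let s₁ := (h 1 one_pos).toFinset
    set P := ‖∏ i ∈ s₁, f i‖ with hP
    set δ := min 1 (ε / (2 * (P + 1))) with hδ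
    have hP0 : 0 ≤ P := norm_nonneg _
    have hδ0 : 0 < δ := by rw [hδ]; positivity
    have hmem : ∀ i ∉ (h δ hδ0).toFinset, ‖f i - 1‖ ≤ δ := fun i hi => by simpa using hi
    have hsub : s₁ ⊆ (h δ hδ0).toFinset := fun i hi => by
      have : 1 < ‖f i - 1‖ := by simpa [s₁] using hi
      rw [Set.Finite.mem_toFinset]
      exact (min_le_left _ _).trans_lt this
    have hle : ‖∏ i ∈ (h δ hδ0).toFinset, f i‖ ≤ P := by
      have h1 := norm_prod_sub_prod_le hsub (f := f) zero_le_one le_rfl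
        fun i hi => by simpa [s₁] using hi
      have h2 := IsUltrametricDist.norm_add_le_max
        (∏ i ∈ (h δ hδ0).toFinset, f i - ∏ i ∈ s₁, f i) (∏ i ∈ s₁, f i)
      rw [sub_add_cancel] at h2
      rw [one_mul] at h1
      exact h2.trans (max_le h1 le_rfl)
    refine ⟨(h δ hδ0).toFinset, fun t ht => ?_⟩
    rw [dist_eq_norm]
    refine (norm_prod_sub_prod_le ht hδ0.le (min_le_left _ _) hmem).trans_lt ?_
    calc δ * ‖∏ i ∈ (h δ hδ0).toFinset, f i‖ ≤ (ε / (2 * (P + 1))) * (P + 1) := by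
          gcongr
          · exact min_le_right _ _
          · linarith
      _ = ε / 2 := by field_simp
      _ < ε := by linarith
  obtain ⟨x, hx⟩ := cauchySeq_tendsto_of_complete hc
  exact ⟨x, hx⟩

end InfiniteProduct

/-! ### The lattice exponential: zeros and first-order behaviour -/

section LatticeExp

variable {F : Type*} [Field F] [Fintype F] {r : ℕ} {Λ : Submodule F[X] (CInfty F)}
  {lam : Fin r → CInfty F}

theorem norm_one_sub_div_sub_one (z l : CInfty F) : ‖1 - z / l - 1‖ = ‖z‖ / ‖l‖ := by
  rw [sub_sub_cancel_left, norm_neg, norm_div]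

theorem finite_lt_norm_div (h : IsSuccessiveMinimumBasis Λ lam) (hΛ : IsLattice r Λ)
    (z : CInfty F) {δ : ℝ} (hδ : 0 < δ) :
    {l : {l : CInfty F // l ∈ Λ ∧ l ≠ 0} | δ < ‖1 - z / (l : CInfty F) - 1‖}.Finite := by
  refine Set.Finite.subset ((h.finite_norm_le hΛ (‖z‖ / δ)).preimage
    (Subtype.val_injective.injOn)) fun l hl => ⟨l.2.1, ?_⟩
  rw [Set.mem_ofPred_eq, norm_one_sub_div_sub_one, lt_div_iff₀ (norm_pos_iff.2 l.2.2)] at hl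
  rw [le_div_iff₀ hδ, mul_comm]
  exact hl.le

theorem multipliable_latticeExp (h : IsSuccessiveMinimumBasis Λ lam) (hΛ : IsLattice r Λ)
    (z : CInfty F) :
    Multipliable fun l : {l : CInfty F // l ∈ Λ ∧ l ≠ 0} => 1 - z / (l : CInfty F) :=
  multipliable_of_forall_finite fun _ hδ => finite_lt_norm_div h hΛ z hδ

theorem latticeExp_of_mem {z : CInfty F} (hz : z ∈ Λ) : latticeExp Λ z = 0 := by
  by_cases hz0 : z = 0
  · simp [latticeExp, hz0]
  · rw [latticeExp, tprod_of_exists_eq_zero ⟨⟨z, hz, hz0⟩, by simp [hz0]⟩, mul_zero]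

/-- A finite partial product approximates the infinite one with relative error at most 1/2, so if
the latter is 0, a factor is 0. -/
theorem mem_of_latticeExp_eq_zero (h : IsSuccessiveMinimumBasis Λ lam) (hΛ : IsLattice r Λ)
    {z : CInfty F} (hz : latticeExp Λ z = 0) : z ∈ Λ := by
  rcases mul_eq_zero.1 hz with rfl | h0
  · exact Λ.zero_mem
  · let s := (finite_lt_norm_div h hΛ z (δ := 1 / 2) (by norm_num)).toFinset
    have h1 := norm_tprod_sub_prod_le (multipliable_latticeExp h hΛ z) (s := s) (δ := 1 / 2)
      (by norm_num) (by norm_num) fun i hi => by simpa [s] using hi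
    rw [h0, zero_sub, norm_neg] at h1
    have h2 : ∏ l ∈ s, (1 - z / (l : CInfty F)) = 0 := by
      rw [← norm_eq_zero]
      linarith [norm_nonneg (∏ l ∈ s, (1 - z / (l : CInfty F)))]
    obtain ⟨l, -, hl⟩ := Finset.prod_eq_zero_iff.1 h2
    have hzl : z = l := eq_of_div_eq_one (sub_eq_zero.1 hl).symm
    exact hzl ▸ l.2.1

/-- The error is quadratic in `z`. At `z/T^m` it is of order `q^(-2m)`, which survives
multiplication by `T^m` or application of `φ_{T^m}`. -/
theorem norm_latticeExp_sub_le [NeZero r] (h : IsSuccessiveMinimumBasis Λ lam)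
    (hΛ : IsLattice r Λ) {z : CInfty F} (hz : ‖z‖ ≤ ‖lam 0‖) :
    ‖latticeExp Λ z - z‖ ≤ ‖z‖ ^ 2 / ‖lam 0‖ := by
  have hpos : 0 < ‖lam 0‖ := norm_pos_iff.2 (h.ne_zero 0)
  have hz1 : ‖z‖ / ‖lam 0‖ ≤ 1 := (div_le_one hpos).2 hz
  have hl : ∀ l : {l : CInfty F // l ∈ Λ ∧ l ≠ 0}, l ∉ (∅ : Finset _) →
      ‖1 - z / (l : CInfty F) - 1‖ ≤ ‖z‖ / ‖lam 0‖ := fun l _ => by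
    rw [norm_one_sub_div_sub_one]
    exact div_le_div_of_nonneg_left (norm_nonneg z) hpos (h.norm_zero_le l.2.1 l.2.2)
  have h1 := norm_tprod_sub_prod_le (multipliable_latticeExp h hΛ z) (by positivity) hz1 hl
  rw [Finset.prod_empty, norm_one, mul_one] at h1
  rw [latticeExp, ← mul_sub_one, norm_mul, sq, mul_div_assoc]
  gcongr

end LatticeExp

/-! ### Additivity of `q`-powers, and splitting of polynomials in `C` -/

section Frobenius

theorem sub_pow_card_pow {F E : Type*} [Field F] [Fintype F] [CommRing E] [Nontrivial E]
    (ψ : F →+* E) (x y : E) (n : ℕ) :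
    (x - y) ^ Fintype.card F ^ n = x ^ Fintype.card F ^ n - y ^ Fintype.card F ^ n := by
  obtain ⟨p, hp⟩ := CharP.exists F
  obtain ⟨k, hprime, hk⟩ := FiniteField.card F p
  have : Fact p.Prime := ⟨hprime⟩
  have : CharP E p := (RingHom.charP_iff_charP ψ p).1 hp
  rw [hk, ← pow_mul, sub_pow_char_pow]

theorem natCast_card_eq_zero {F E : Type*} [Field F] [Fintype F] [CommRing E] (ψ : F →+* E) :
    (Fintype.card F : E) = 0 := by
  rw [← map_natCast ψ, FiniteField.cast_card_eq_zero, map_zero]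

end Frobenius

section AlgebraicallyClosed

variable {F : Type*} [Field F] [Fintype F]

theorem isAlgClosed_algebraicClosure : IsAlgClosed (algebraicClosure (KInfty F) (CInfty F)) := by
  let ι : AlgebraicClosure (KInfty F) →+* CInfty F := UniformSpace.Completion.coeRingHom
  have hι : ∀ x, ι (algebraMap (KInfty F) _ x) = algebraMap (KInfty F) (CInfty F) x := fun x => rfl
  let ι' : AlgebraicClosure (KInfty F) →ₐ[KInfty F] CInfty F := { ι with commutes' := hι }
  let j : AlgebraicClosure (KInfty F) →ₐ[KInfty F] algebraicClosure (KInfty F) (CInfty F) :=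
    ι'.codRestrict (algebraicClosure (KInfty F) (CInfty F)).toSubalgebra fun x => by
      change ι' x ∈ algebraicClosure (KInfty F) (CInfty F)
      rw [mem_algebraicClosure_iff]
      exact (Algebra.IsAlgebraic.isAlgebraic x).algHom ι'
  have hj : Function.Bijective j := by
    refine ⟨j.toRingHom.injective, ?_⟩
    refine IsAlgClosed.ringHom_bijective_of_isIntegral j.toRingHom ?_ |>.2
    intro x
    have hx : IsIntegral (KInfty F) x := Algebra.IsIntegral.isIntegral x
    obtain ⟨P, hP, hP0⟩ := hx
    refine ⟨P.map (algebraMap _ _), hP.map _, ?_⟩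
    rw [Polynomial.eval₂_map]
    convert hP0
    ext x
    simp
  exact IsAlgClosed.of_ringEquiv _ _ (RingEquiv.ofBijective j hj)

/-- `L` is algebraic over `K_∞`, so the roots lie in the algebraic closure of `K_∞` inside `C`;
algebraic closedness of `C` itself is not needed. -/
theorem splits_map_algebraMap (L : IntermediateField (KInfty F) (CInfty F))
    [FiniteDimensional (KInfty F) L] (P : Polynomial L) :
    (P.map (algebraMap L (CInfty F))).Splits := by
  have hle : L ≤ algebraicClosure (KInfty F) (CInfty F) := fun x hx => by
    rw [mem_algebraicClosure_iff]
    have : IsAlgebraic (KInfty F) (⟨x, hx⟩ : L) := Algebra.IsAlgebraic.isAlgebraic _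
    exact this.algHom L.val
  have := isAlgClosed_algebraicClosure (F := F)
  have h1 := IsAlgClosed.splits (P.map (IntermediateField.inclusion hle).toRingHom)
  have h2 := h1.map (algebraMap (algebraicClosure (KInfty F) (CInfty F)) (CInfty F))
  rw [Polynomial.map_map] at h2
  exact h2

end AlgebraicallyClosed

/-! ### The operator `φ_T` near the origin, and separability of `φ_{T^m}` -/

namespace DrinfeldModule

variable {F : Type*} [Field F] [Fintype F] {L : IntermediateField (KInfty F) (CInfty F)} {r : ℕ}
  (φ : DrinfeldModule L r)

/-- The non-linear part of `φ_T`, as a function on `C`. -/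
def higherPart (z : CInfty F) : CInfty F :=
  ∑ i : Fin r, (φ.coeff i : CInfty F) * z ^ Fintype.card F ^ ((i : ℕ) + 1)

theorem aeval_operatorT (z : CInfty F) :
    Polynomial.aeval z φ.operatorT =
      algebraMap (KInfty F) (CInfty F) (T F) * z + φ.higherPart z := by
  simp only [operatorT, higherPart, map_add, map_mul, map_sum, map_pow, Polynomial.aeval_C,
    Polynomial.aeval_X]
  rfl

theorem higherPart_sub (x y : CInfty F) :
    φ.higherPart (x - y) = φ.higherPart x - φ.higherPart y := by
  simp only [higherPart, ← Finset.sum_sub_distrib, ← mul_sub]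
  refine Finset.sum_congr rfl fun i _ => ?_
  rw [sub_pow_card_pow ((algebraMap F[X] (CInfty F)).comp Polynomial.C)]

theorem aeval_operatorT_sub (x y : CInfty F) :
    Polynomial.aeval (x - y) φ.operatorT =
      Polynomial.aeval x φ.operatorT - Polynomial.aeval y φ.operatorT := by
  simp only [aeval_operatorT, higherPart_sub]
  ring

/-- All exponents are at least 2, so on a small ball the nonlinear part is at most `‖z‖`, whereas
the linear part has norm `q‖z‖`. -/
theorem exists_norm_higherPart_le :
    ∃ ρ : ℝ, 0 < ρ ∧ ∀ z : CInfty F, ‖z‖ ≤ ρ → ‖φ.higherPart z‖ ≤ ‖z‖ := by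
  have hpos : 0 < 1 + ∑ i, ‖(φ.coeff i : CInfty F)‖ := by positivity
  refine ⟨(1 + ∑ i, ‖(φ.coeff i : CInfty F)‖)⁻¹, by positivity, fun z hz => ?_⟩
  refine IsUltrametricDist.norm_sum_le_of_forall_le_of_nonneg (norm_nonneg z) fun i _ => ?_
  have hz1 : ‖z‖ ≤ 1 := hz.trans (inv_le_one_of_one_le₀ (by
    linarith [Finset.sum_nonneg fun (i : Fin r) (_ : i ∈ Finset.univ) =>
      norm_nonneg (φ.coeff i : CInfty F)]))
  have hcard : 2 ≤ Fintype.card F ^ ((i : ℕ) + 1) :=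
    (Nat.succ_le_of_lt (Fintype.one_lt_card (α := F))).trans (Nat.le_self_pow (by omega) _)
  have hg : ‖(φ.coeff i : CInfty F)‖ ≤ 1 + ∑ i, ‖(φ.coeff i : CInfty F)‖ := by
    have := Finset.single_le_sum (f := fun i => ‖(φ.coeff i : CInfty F)‖)
      (fun i _ => norm_nonneg _) (Finset.mem_univ i)
    linarith
  rw [norm_mul, norm_pow]
  calc _ ≤ (1 + ∑ i, ‖(φ.coeff i : CInfty F)‖) * ‖z‖ ^ 2 := by
        gcongr ?_ * ?_
        exact pow_le_pow_of_le_one (norm_nonneg z) hz1 hcard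
    _ = ((1 + ∑ i, ‖(φ.coeff i : CInfty F)‖) * ‖z‖) * ‖z‖ := by ring
    _ ≤ 1 * ‖z‖ := by
        gcongr
        rwa [← le_inv_mul_iff₀ hpos, mul_one]
    _ = ‖z‖ := one_mul _

theorem norm_T_CInfty : ‖algebraMap (KInfty F) (CInfty F) (T F)‖ = Fintype.card F := by
  rw [norm_algebraMap', norm_T]

theorem T_CInfty_ne_zero : algebraMap (KInfty F) (CInfty F) (T F) ≠ 0 := by
  rw [← norm_pos_iff, norm_T_CInfty]
  exact zero_lt_one.trans one_lt_card_real

variable {φ}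

theorem norm_iterate_le {ρ : ℝ} (hρ : ∀ z : CInfty F, ‖z‖ ≤ ρ → ‖φ.higherPart z‖ ≤ ‖z‖)
    (m : ℕ) {z : CInfty F} (hz : (Fintype.card F : ℝ) ^ m * ‖z‖ ≤ ρ) :
    ‖(fun x => Polynomial.aeval x φ.operatorT)^[m] z‖ ≤ (Fintype.card F : ℝ) ^ m * ‖z‖ := by
  have hq := one_lt_card_real (F := F)
  induction m with
  | zero => simp
  | succ m ih =>
    rw [Function.iterate_succ_apply']
    have hle : (Fintype.card F : ℝ) ^ m * ‖z‖ ≤ (Fintype.card F : ℝ) ^ (m + 1) * ‖z‖ := by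
      gcongr
      · exact hq.le
      · omega
    have h1 := ih (hle.trans hz)
    rw [aeval_operatorT]
    refine (IsUltrametricDist.norm_add_le_max _ _).trans (max_le ?_ ?_)
    · rw [norm_mul, norm_T_CInfty, pow_succ', mul_assoc]
      gcongr
    · exact (hρ _ (h1.trans (hle.trans hz))).trans (h1.trans hle)

theorem iterate_sub (m : ℕ) (x y : CInfty F) :
    (fun x => Polynomial.aeval x φ.operatorT)^[m] (x - y) =
      (fun x => Polynomial.aeval x φ.operatorT)^[m] x -
        (fun x => Polynomial.aeval x φ.operatorT)^[m] y := by
  induction m with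
  | zero => rfl
  | succ m ih => simp only [Function.iterate_succ_apply', ih, aeval_operatorT_sub]

/-- Small preimages under `φ_T` of elements of a closed field containing `L` lie in that field. -/
theorem mem_of_aeval_operatorT_mem {ρ : ℝ}
    (hρ : ∀ z : CInfty F, ‖z‖ ≤ ρ → ‖φ.higherPart z‖ ≤ ‖z‖)
    {M : IntermediateField L (CInfty F)} (hM : IsClosed (M : Set (CInfty F))) {y : CInfty F}
    (hy : ‖y‖ ≤ ρ) (hmem : Polynomial.aeval y φ.operatorT ∈ M) : y ∈ M := by
  have hq := one_lt_card_real (F := F)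
  set θ := algebraMap (KInfty F) (CInfty F) (T F) with hθ
  have hθ0 : θ ≠ 0 := T_CInfty_ne_zero
  set x := Polynomial.aeval y φ.operatorT with hx
  -- Fixed-point iteration for `φ_T(w) = x`: the map sends `M` to itself, fixes `y` and, on the
  -- ball, shrinks the distance to `y` by a factor `q`.
  let u : ℕ → CInfty F := fun n => (fun w => (x - φ.higherPart w) / θ)^[n] 0
  have hu : ∀ n, u (n + 1) = (x - φ.higherPart (u n)) / θ := fun n =>
    Function.iterate_succ_apply' _ _ _
  have hθM : θ ∈ M := M.algebraMap_mem (algebraMap (KInfty F) L (T F))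
  have huM : ∀ n, u n ∈ M := fun n => by
    induction n with
    | zero => exact M.zero_mem
    | succ n ih =>
      rw [hu]
      refine M.div_mem (M.sub_mem hmem (M.sum_mem fun i _ => ?_)) hθM
      exact M.mul_mem (M.algebraMap_mem (φ.coeff i)) (pow_mem ih _)
  have hdist : ∀ n, ‖u n - y‖ ≤ ρ * ((Fintype.card F : ℝ)⁻¹) ^ n := fun n => by
    induction n with
    | zero => simpa [u] using hy
    | succ n ih =>
      have hle : ‖u n - y‖ ≤ ρ := ih.trans (mul_le_of_le_one_right ((norm_nonneg y).trans hy)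
        (pow_le_one₀ (by positivity) (inv_le_one_of_one_le₀ hq.le)))
      have h1 : u (n + 1) - y = - φ.higherPart (u n - y) / θ := by
        rw [hu, higherPart_sub, hx, aeval_operatorT, ← hθ]
        field_simp
        ring
      rw [h1, norm_div, norm_neg, hθ, norm_T_CInfty, pow_succ, ← mul_assoc, div_eq_mul_inv]
      gcongr
      exact (hρ _ hle).trans ih
  have hlim : Tendsto u atTop (𝓝 y) := by
    rw [tendsto_iff_norm_sub_tendsto_zero]
    refine squeeze_zero (fun n => norm_nonneg _) hdist ?_
    have := tendsto_pow_atTop_nhds_zero_of_lt_one (r := (Fintype.card F : ℝ)⁻¹) (by positivity)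
      (inv_lt_one_of_one_lt₀ hq)
    simpa using this.const_mul ρ
  exact hM.mem_of_tendsto hlim (Eventually.of_forall huM)

variable (φ)

/-- The polynomial `φ_{T^m}`. -/
def operatorTPow (m : ℕ) : Polynomial L := (fun P => φ.operatorT.comp P)^[m] Polynomial.X

theorem aeval_operatorTPow {E : Type*} [Field E] [Algebra L E] (m : ℕ) (z : E) :
    Polynomial.aeval z (φ.operatorTPow m) = (fun x => Polynomial.aeval x φ.operatorT)^[m] z := by
  induction m with
  | zero => simp [operatorTPow]
  | succ m ih =>
    rw [operatorTPow, Function.iterate_succ_apply', Function.iterate_succ_apply',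
      Polynomial.aeval_comp, ← ih, operatorTPow]

theorem derivative_operatorT :
    φ.operatorT.derivative = Polynomial.C (algebraMap (KInfty F) L (T F)) := by
  have h0 : ((Fintype.card F : ℕ) : Polynomial L) = 0 := natCast_card_eq_zero
    (Polynomial.C.comp ((algebraMap (KInfty F) L).comp
      ((algebraMap F[X] (KInfty F)).comp Polynomial.C)))
  simp [operatorT, Polynomial.derivative_X_pow, h0]

theorem derivative_operatorTPow (m : ℕ) :
    (φ.operatorTPow m).derivative = Polynomial.C (algebraMap (KInfty F) L (T F) ^ m) := by
  induction m with
  | zero => simp [operatorTPow]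
  | succ m ih =>
    rw [operatorTPow, Function.iterate_succ_apply', Polynomial.derivative_comp,
      derivative_operatorT, Polynomial.C_comp, ← operatorTPow, ih, ← Polynomial.C_mul, pow_succ]

theorem T_intermediateField_ne_zero : algebraMap (KInfty F) L (T F) ≠ 0 := fun h =>
  T_CInfty_ne_zero (F := F) (congrArg (algebraMap L (CInfty F)) h)

/-- Since `q = 0` in `L`, the derivative is the nonzero constant `T^m`. -/
theorem separable_operatorTPow (m : ℕ) : (φ.operatorTPow m).Separable := by
  rw [Polynomial.Separable, derivative_operatorTPow]
  exact isCoprime_one_right.of_isCoprime_of_dvd_right (IsUnit.dvd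
    (Polynomial.isUnit_C.2 (IsUnit.mk0 _ (pow_ne_zero _ T_intermediateField_ne_zero))))

end DrinfeldModule

/-! ### Division points and the Galois action on periods -/

section PeriodLattice

variable {F : Type*} [Field F] [Fintype F] {L : IntermediateField (KInfty F) (CInfty F)} {r : ℕ}
  {φ : DrinfeldModule L r} {Λ : Submodule F[X] (CInfty F)} {lam : Fin r → CInfty F}

local notation "θ" => algebraMap (KInfty F) (CInfty F) (T F)

theorem IsPeriodLattice.iterate_latticeExp (h : IsPeriodLattice φ Λ) (m : ℕ) (z : CInfty F) :
    (fun x => Polynomial.aeval x φ.operatorT)^[m] (latticeExp Λ (z / θ ^ m)) =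
      latticeExp Λ z := by
  have hθ := DrinfeldModule.T_CInfty_ne_zero (F := F)
  induction m generalizing z with
  | zero => simp
  | succ m ih =>
    rw [Function.iterate_succ_apply, ← h.exp_T_mul, ← ih z]
    congr 2
    field_simp
    ring

theorem norm_div_T_pow (z : CInfty F) (m : ℕ) :
    ‖z / θ ^ m‖ = ‖z‖ / (Fintype.card F : ℝ) ^ m := by
  rw [norm_div, norm_pow, DrinfeldModule.norm_T_CInfty]

theorem exists_forall_norm_div_le (R : ℝ) {c : ℝ} (hc : 0 < c) :
    ∃ N : ℕ, ∀ m, N ≤ m → R / (Fintype.card F : ℝ) ^ m ≤ c := by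
  have hq := one_lt_card_real (F := F)
  obtain ⟨N, hN⟩ := pow_unbounded_of_one_lt (R / c) hq
  refine ⟨N, fun m hm => ?_⟩
  rw [div_le_iff₀ (by positivity), mul_comm, ← div_le_iff₀ hc]
  exact hN.le.trans (pow_le_pow_right₀ hq.le hm)

variable [NeZero r]

theorem norm_latticeExp_div_sub_le (hlam : IsSuccessiveMinimumBasis Λ lam) (hΛ : IsLattice r Λ)
    {z : CInfty F} {m : ℕ} (hz : ‖z‖ / (Fintype.card F : ℝ) ^ m ≤ ‖lam 0‖) :
    ‖latticeExp Λ (z / θ ^ m) - z / θ ^ m‖ ≤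
      (‖z‖ / (Fintype.card F : ℝ) ^ m) ^ 2 / ‖lam 0‖ := by
  rw [← norm_div_T_pow] at hz ⊢
  exact norm_latticeExp_sub_le hlam hΛ hz

theorem norm_latticeExp_div_le (hlam : IsSuccessiveMinimumBasis Λ lam) (hΛ : IsLattice r Λ)
    {z : CInfty F} {m : ℕ} (hz : ‖z‖ / (Fintype.card F : ℝ) ^ m ≤ ‖lam 0‖) :
    ‖latticeExp Λ (z / θ ^ m)‖ ≤ ‖z‖ / (Fintype.card F : ℝ) ^ m := by
  have hpos : 0 < ‖lam 0‖ := norm_pos_iff.2 (hlam.ne_zero 0)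
  have h1 := norm_latticeExp_div_sub_le hlam hΛ hz
  rw [← sub_add_cancel (latticeExp Λ (z / θ ^ m)) (z / θ ^ m)]
  refine (IsUltrametricDist.norm_add_le_max _ _).trans
    (max_le (h1.trans ?_) (norm_div_T_pow z m).le)
  rw [div_le_iff₀ hpos, sq]
  gcongr

theorem tendsto_T_pow_mul_latticeExp (hlam : IsSuccessiveMinimumBasis Λ lam)
    (hΛ : IsLattice r Λ) (z : CInfty F) :
    Tendsto (fun m : ℕ => θ ^ m * latticeExp Λ (z / θ ^ m)) atTop (𝓝 z) := by
  have hθ := DrinfeldModule.T_CInfty_ne_zero (F := F)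
  have hq := one_lt_card_real (F := F)
  have hpos : 0 < ‖lam 0‖ := norm_pos_iff.2 (hlam.ne_zero 0)
  obtain ⟨N, hN⟩ := exists_forall_norm_div_le (F := F) ‖z‖ hpos
  rw [tendsto_iff_norm_sub_tendsto_zero]
  have hlim : Tendsto (fun m : ℕ => ‖z‖ ^ 2 / ‖lam 0‖ * ((Fintype.card F : ℝ)⁻¹) ^ m) atTop
      (𝓝 0) := by
    have := tendsto_pow_atTop_nhds_zero_of_lt_one (r := (Fintype.card F : ℝ)⁻¹) (by positivity)
      (inv_lt_one_of_one_lt₀ hq)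
    simpa using this.const_mul (‖z‖ ^ 2 / ‖lam 0‖)
  refine squeeze_zero' (Eventually.of_forall fun m => norm_nonneg _)
    ((eventually_ge_atTop N).mono fun m hm => ?_) hlim
  have h1 := norm_latticeExp_div_sub_le hlam hΛ (hN m hm)
  have h2 : θ ^ m * latticeExp Λ (z / θ ^ m) - z =
      θ ^ m * (latticeExp Λ (z / θ ^ m) - z / θ ^ m) := by
    rw [mul_sub, mul_div_cancel₀ _ (pow_ne_zero m hθ)]
  rw [h2, norm_mul, norm_pow, DrinfeldModule.norm_T_CInfty]
  calc _ ≤ (Fintype.card F : ℝ) ^ m *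
        ((‖z‖ / (Fintype.card F : ℝ) ^ m) ^ 2 / ‖lam 0‖) := by gcongr
    _ = _ := by rw [inv_pow]; field_simp

/-- An extension of `L` containing a sufficiently small division point of `z` contains `z`. -/
theorem mem_of_latticeExp_div_mem (h : IsPeriodLattice φ Λ)
    (hlam : IsSuccessiveMinimumBasis Λ lam) {ρ : ℝ}
    (hρ : ∀ z : CInfty F, ‖z‖ ≤ ρ → ‖φ.higherPart z‖ ≤ ‖z‖)
    {M : IntermediateField L (CInfty F)} (hM : IsClosed (M : Set (CInfty F))) {z : CInfty F}
    {N : ℕ} (hN : ∀ m, N ≤ m → ‖z‖ / (Fintype.card F : ℝ) ^ m ≤ ‖lam 0‖)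
    (hNρ : ∀ m, N ≤ m → ‖z‖ / (Fintype.card F : ℝ) ^ m ≤ ρ)
    (hmem : latticeExp Λ (z / θ ^ N) ∈ M) :
    (∀ m, N ≤ m → latticeExp Λ (z / θ ^ m) ∈ M) ∧ z ∈ M := by
  have hθ := DrinfeldModule.T_CInfty_ne_zero (F := F)
  have hall : ∀ m, N ≤ m → latticeExp Λ (z / θ ^ m) ∈ M := fun m hm => by
    induction m, hm using Nat.le_induction with
    | base => exact hmem
    | succ m hm ih =>
      -- `e_Λ(z/T^(m+1))` is a small preimage of `e_Λ(z/T^m)` under `φ_T`.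
      refine DrinfeldModule.mem_of_aeval_operatorT_mem hρ hM
        ((norm_latticeExp_div_le hlam h.isLattice (hN (m + 1) (by omega))).trans
          (hNρ (m + 1) (by omega))) ?_
      rw [← h.exp_T_mul]
      convert ih using 2
      field_simp
      ring
  refine ⟨hall, hM.mem_of_tendsto (tendsto_T_pow_mul_latticeExp hlam h.isLattice z)
    ((eventually_ge_atTop N).mono fun m hm => M.mul_mem (pow_mem ?_ m) (hall m hm))⟩
  exact M.algebraMap_mem (algebraMap (KInfty F) L (T F))

/-- The automorphisms of a finite extension of `L` preserve the periods. -/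
theorem algEquiv_mem_lattice [FiniteDimensional (KInfty F) L] (h : IsPeriodLattice φ Λ)
    (hlam : IsSuccessiveMinimumBasis Λ lam) {M : IntermediateField L (CInfty F)}
    [FiniteDimensional L M] {x : M} (hx : (x : CInfty F) ∈ Λ) {N : ℕ}
    (hmem : ∀ m, N ≤ m → latticeExp Λ (x / θ ^ m) ∈ M) (σ : M ≃ₐ[L] M) :
    (σ x : CInfty F) ∈ Λ := by
  have hq := one_lt_card_real (F := F)
  have hpos : 0 < ‖lam 0‖ := norm_pos_iff.2 (hlam.ne_zero 0)
  obtain ⟨ρ, hρ0, hρ⟩ := φ.exists_norm_higherPart_le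
  refine mem_of_latticeExp_eq_zero hlam h.isLattice (norm_le_zero_iff.1 ?_)
  set A := ‖(x : CInfty F)‖ ^ 2 / ‖lam 0‖ with hA
  obtain ⟨N₁, hN₁⟩ := exists_forall_norm_div_le (F := F) ‖(x : CInfty F)‖ hpos
  obtain ⟨N₂, hN₂⟩ := exists_forall_norm_div_le (F := F) A hρ0
  refine le_of_forall_pos_le_add fun ε hε => ?_
  obtain ⟨N₃, hN₃⟩ := exists_forall_norm_div_le (F := F) A hε
  obtain ⟨m, hm⟩ : ∃ m, m = max (max N N₁) (max N₂ N₃) := ⟨_, rfl⟩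
  have hmN : N ≤ m := by omega
  have hm1 := hN₁ m (by omega)
  have hm2 := hN₂ m (by omega)
  have hm3 := hN₃ m (by omega)
  let y : M := ⟨latticeExp Λ (x / θ ^ m), hmem m hmN⟩
  let θM : M := algebraMap L M (algebraMap (KInfty F) L (T F))
  have hσθ : σ θM = θM := σ.commutes _
  have hy0 : Polynomial.aeval y (φ.operatorTPow m) = 0 := by
    apply (algebraMap M (CInfty F)).injective
    rw [← Polynomial.aeval_algebraMap_apply, map_zero, φ.aeval_operatorTPow]
    exact (h.iterate_latticeExp m x).trans (latticeExp_of_mem hx)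
  have hσy0 : (fun x => Polynomial.aeval x φ.operatorT)^[m] (σ y : CInfty F) = 0 := by
    rw [← φ.aeval_operatorTPow]
    have h1 : Polynomial.aeval (σ y) (φ.operatorTPow m) = 0 := by
      have := Polynomial.aeval_algHom_apply (σ : M →ₐ[L] M) y (φ.operatorTPow m)
      rw [hy0, map_zero] at this
      exact this
    have := Polynomial.aeval_algebraMap_apply (CInfty F) (σ y) (φ.operatorTPow m)
    rw [h1, map_zero] at this
    exact this
  have hdiff1 : ‖(y : CInfty F) - x / θ ^ m‖ ≤ A / ((Fintype.card F : ℝ) ^ m) ^ 2 := by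
    refine (norm_latticeExp_div_sub_le hlam h.isLattice hm1).trans_eq ?_
    rw [hA]; field_simp
  -- `σ` fixes `T` and is an isometry, so it transports the estimate for `y` to `σ y`.
  have hdiff2 : ‖(σ y : CInfty F) - σ x / θ ^ m‖ ≤ A / ((Fintype.card F : ℝ) ^ m) ^ 2 := by
    have h1 : (σ y : CInfty F) - σ x / θ ^ m = (σ (y - x / θM ^ m) : M) := by
      rw [map_sub, map_div₀, map_pow, hσθ]; rfl
    rw [h1, norm_algEquiv]
    exact hdiff1
  have hσx : ‖(σ x : CInfty F)‖ = ‖(x : CInfty F)‖ := norm_algEquiv M σ x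
  have hdiff3 : ‖latticeExp Λ (σ x / θ ^ m) - σ x / θ ^ m‖ ≤
      A / ((Fintype.card F : ℝ) ^ m) ^ 2 := by
    rw [← hσx] at hm1
    refine (norm_latticeExp_div_sub_le hlam h.isLattice hm1).trans_eq ?_
    rw [hA, hσx]; field_simp
  have hdiff : ‖latticeExp Λ (σ x / θ ^ m) - σ y‖ ≤ A / ((Fintype.card F : ℝ) ^ m) ^ 2 := by
    rw [← sub_sub_sub_cancel_right _ _ ((σ x : CInfty F) / θ ^ m), sub_eq_add_neg]
    exact (IsUltrametricDist.norm_add_le_max _ _).trans (max_le hdiff3 (by rwa [norm_neg]))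
  have hq' : (Fintype.card F : ℝ) ^ m * ‖latticeExp Λ (σ x / θ ^ m) - σ y‖ ≤
      A / (Fintype.card F : ℝ) ^ m := by
    calc _ ≤ (Fintype.card F : ℝ) ^ m * (A / ((Fintype.card F : ℝ) ^ m) ^ 2) := by gcongr
      _ = _ := by field_simp
  -- `φ_{T^m}` is additive and kills `σ y`, so `e_Λ(σ x)` is the image of the difference `e_Λ(σ
  -- x/T^m) - σ y`, of norm at most `A/q^(2m)`. Small elements grow by at most `q^m`, leaving `A/q^m
  -- ≤ ε`.
  rw [← h.iterate_latticeExp m, ← sub_zero ((fun x => Polynomial.aeval x φ.operatorT)^[m] _),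
    ← hσy0, ← DrinfeldModule.iterate_sub, zero_add]
  exact (DrinfeldModule.norm_iterate_le hρ m (hq'.trans hm2)).trans (hq'.trans hm3)

theorem algEquiv_eq_sum_smul {M : IntermediateField L (CInfty F)} (σ : M ≃ₐ[L] M) {ι : Type*}
    [Fintype ι] {x : M} {y : ι → M} {a : ι → F[X]}
    (h : (x : CInfty F) = ∑ i, a i • (y i : CInfty F)) :
    (σ x : CInfty F) = ∑ i, a i • (σ (y i) : CInfty F) := by
  let aM : ι → M := fun i => algebraMap L M
    (algebraMap (KInfty F) L (algebraMap F[X] (KInfty F) (a i)))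
  have hx : x = ∑ i, aM i * y i := by
    apply (algebraMap M (CInfty F)).injective
    rw [map_sum]
    exact h.trans (Finset.sum_congr rfl fun i _ => Algebra.smul_def _ _)
  rw [hx, map_sum, IntermediateField.coe_sum]
  refine Finset.sum_congr rfl fun i _ => ?_
  rw [map_mul, σ.commutes, Algebra.smul_def]
  rfl

theorem exists_isGalois_lattice_subset [FiniteDimensional (KInfty F) L] (h : IsPeriodLattice φ Λ)
    (hlam : IsSuccessiveMinimumBasis Λ lam) :
    ∃ M : IntermediateField L (CInfty F), FiniteDimensional L M ∧ IsGalois L M ∧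
      (Λ : Set (CInfty F)) ⊆ M ∧
      ∀ (σ : M ≃ₐ[L] M) (x : M), (x : CInfty F) ∈ Λ → (σ x : CInfty F) ∈ Λ := by
  have hpos : 0 < ‖lam 0‖ := norm_pos_iff.2 (hlam.ne_zero 0)
  obtain ⟨ρ, hρ0, hρ⟩ := φ.exists_norm_higherPart_le
  choose N₁ hN₁ using fun i => exists_forall_norm_div_le (F := F) ‖lam i‖ (lt_min hpos hρ0)
  set N := Finset.univ.sup N₁ with hN
  have hNle : ∀ i, N₁ i ≤ N := fun i => Finset.le_sup (Finset.mem_univ i)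
  set P := φ.operatorTPow N with hP
  let M := IntermediateField.adjoin L (P.rootSet (CInfty F))
  have : P.IsSplittingField L M :=
    IntermediateField.adjoin_rootSet_isSplittingField (splits_map_algebraMap L P)
  have hfin : FiniteDimensional L M := Polynomial.IsSplittingField.finiteDimensional M P
  have hsep := φ.separable_operatorTPow N
  have hclosed := isClosed_intermediateField M
  have hdiv : ∀ l ∈ Λ, latticeExp Λ (l / θ ^ N) ∈ M := fun l hl => by
    refine IntermediateField.subset_adjoin _ _ ?_
    rw [Polynomial.mem_rootSet]
    refine ⟨hsep.ne_zero, ?_⟩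
    rw [φ.aeval_operatorTPow, h.iterate_latticeExp, latticeExp_of_mem hl]
  have hlamM : ∀ i, (∀ m, N ≤ m → latticeExp Λ (lam i / θ ^ m) ∈ M) ∧ lam i ∈ M := fun i =>
    mem_of_latticeExp_div_mem h hlam hρ hclosed
      (fun m hm => (hN₁ i m ((hNle i).trans hm)).trans (min_le_left _ _))
      (fun m hm => (hN₁ i m ((hNle i).trans hm)).trans (min_le_right _ _)) (hdiv _ (hlam.mem i))
  have hpoly : ∀ a : F[X], algebraMap F[X] (CInfty F) a ∈ M := fun a =>
    M.algebraMap_mem (algebraMap (KInfty F) L (algebraMap F[X] (KInfty F) a))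
  refine ⟨M, hfin, IsGalois.of_separable_splitting_field hsep, fun l hl => ?_, fun σ x hx => ?_⟩
  · obtain ⟨a, rfl⟩ := hlam.exists_eq_sum h.isLattice hl
    refine M.sum_mem fun i _ => ?_
    rw [Algebra.smul_def]
    exact M.mul_mem (hpoly _) (hlamM i).2
  · obtain ⟨a, ha⟩ := hlam.exists_eq_sum h.isLattice hx
    rw [algEquiv_eq_sum_smul (y := fun i => ⟨lam i, (hlamM i).2⟩) σ ha]
    have hmem : ∀ i, (σ ⟨lam i, (hlamM i).2⟩ : CInfty F) ∈ Λ := fun i =>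
      algEquiv_mem_lattice (x := ⟨lam i, (hlamM i).2⟩) h hlam (hlam.mem i) (hlamM i).1 σ
    exact Λ.sum_mem fun i _ => Λ.smul_mem _ (hmem i)

end PeriodLattice

/-! ### Orders of block triangular matrices -/

section MatrixOrder

variable {F : Type*} [Field F]

/-- By Cayley–Hamilton, distinct powers of `D` give distinct remainders of `X^k` modulo the
characteristic polynomial. These are nonzero, since no power of `D` vanishes when the order is
positive, and there are `q^n - 1` nonzero remainders. -/
theorem orderOf_matrix_le [Fintype F] {ι : Type*} [Fintype ι] [DecidableEq ι] [Nonempty ι]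
    (D : Matrix ι ι F) :
    orderOf D ≤ Fintype.card F ^ Fintype.card ι - 1 := by
  classical
  set n := Fintype.card ι with hn
  let P : ℕ → F[X] := fun k => Polynomial.X ^ k %ₘ D.charpoly
  have hmonic := D.charpoly_monic
  have hP : ∀ k, P k ∈ Polynomial.degreeLT F n := fun k => by
    rw [Polynomial.mem_degreeLT]
    refine (Polynomial.degree_modByMonic_lt _ hmonic).trans_eq ?_
    rw [D.charpoly_degree_eq_dim]
  have hDP : ∀ k, Polynomial.aeval D (P k) = D ^ k := fun k => by
    rw [Polynomial.aeval_modByMonic_eq_self_of_root D.aeval_self_charpoly, map_pow,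
      Polynomial.aeval_X]
  let v : ℕ → Fin n → F := fun k => Polynomial.degreeLTEquiv F n ⟨P k, hP k⟩
  have hv : ∀ k l, v k = v l → D ^ k = D ^ l := fun k l hkl => by
    have hP : P k = P l := Subtype.ext_iff.1 ((Polynomial.degreeLTEquiv F n).injective hkl)
    rw [← hDP, ← hDP, hP]
  have hv0 : ∀ k < orderOf D, v k ≠ 0 := fun k hk h0 => by
    have h1 : P k = 0 := Subtype.ext_iff.1 ((LinearEquiv.map_eq_zero_iff _).1 h0)
    have h2 : D ^ k = 0 := by rw [← hDP, h1, map_zero]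
    have h3 : D ^ orderOf D = 0 := by
      rw [← Nat.sub_add_cancel hk.le, pow_add, h2, mul_zero]
    rw [pow_orderOf_eq_one] at h3
    exact one_ne_zero h3
  have hcard := Finset.card_le_card_of_injOn (s := Finset.range (orderOf D))
    (t := (Finset.univ : Finset (Fin n → F)).erase 0) v
    (fun k hk => Finset.mem_coe.2 (Finset.mem_erase.2
      ⟨hv0 k (Finset.mem_range.1 hk), Finset.mem_univ _⟩))
    (fun k hk l hl hkl => pow_injOn_Iio_orderOf (Finset.mem_range.1 hk) (Finset.mem_range.1 hl)
      (hv k l hkl))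
  rwa [Finset.card_range, Finset.card_erase_of_mem (Finset.mem_univ _), Finset.card_univ,
    Fintype.card_fun, Fintype.card_fin] at hcard

section BlockTriangular

variable {ι : Type*} [Fintype ι] [DecidableEq ι] {t : ℕ} {R : Type*} [CommRing R]

/-- Each factor `N` moves the block index by at least one, so `k` factors move it by at least `k`;
with only `t` blocks, `N^t = 0`. -/
theorem block_pow_apply_eq_zero {N : Matrix ι ι R} {b : ι → Fin t}
    (hN : ∀ i j, b i ≤ b j → N i j = 0) (k : ℕ) (i j : ι) (hij : (b i : ℕ) < b j + k) :
    (N ^ k) i j = 0 := by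
  induction k generalizing i j with
  | zero =>
    rw [pow_zero, Matrix.one_apply_ne]
    rintro rfl
    simp at hij
  | succ k ih =>
    rw [pow_succ, Matrix.mul_apply]
    refine Finset.sum_eq_zero fun l _ => ?_
    rcases le_or_gt (b l) (b j) with hlj | hlj
    · rw [hN l j hlj, mul_zero]
    · rw [ih i l (by rw [Fin.lt_def] at hlj; omega), zero_mul]

/-- A block triangular unipotent matrix with `t` blocks has order dividing `p ^ (t - 1)`. -/
theorem block_unipotent_pow_eq_one [Nonempty ι] (p : ℕ) [hp : Fact p.Prime] [CharP R p]
    {U : Matrix ι ι R} {b : ι → Fin t} (hU : ∀ i j, b i ≤ b j → U i j = (1 : Matrix ι ι R) i j) :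
    U ^ p ^ (t - 1) = 1 := by
  have hN : (U - 1) ^ t = 0 := by
    ext i j
    exact block_pow_apply_eq_zero (fun i j hij => by rw [Matrix.sub_apply, hU i j hij, sub_self])
      t i j (by omega)
  -- This inequality is why the exponent `t - 1` suffices: `(U - 1)^(p^(t-1))` is then 0 and equals
  -- `U^(p^(t-1)) - 1`.
  have ht : t ≤ p ^ (t - 1) := by
    have := Nat.lt_pow_self hp.out.one_lt (n := t - 1)
    omega
  have h := sub_pow_char_pow_of_commute p (t - 1) (Commute.one_right U)
  rw [one_pow, pow_eq_zero_of_le ht hN] at h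
  exact (sub_eq_zero.1 h.symm)

theorem blockTriangular_pow {A : Matrix ι ι R} {b : ι → Fin t}
    (h0 : ∀ i j, b i < b j → A i j = 0) (n : ℕ) (i j : ι) (hij : b i < b j) : (A ^ n) i j = 0 := by
  induction n generalizing i j with
  | zero =>
    rw [pow_zero, Matrix.one_apply_ne]
    rintro rfl
    exact lt_irrefl _ hij
  | succ n ih =>
    rw [pow_succ, Matrix.mul_apply]
    refine Finset.sum_eq_zero fun l _ => ?_
    rcases lt_or_ge (b l) (b j) with hlj | hlj
    · rw [h0 l j hlj, mul_zero]
    · rw [ih i l (hij.trans_le hlj), zero_mul]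

variable {A : Matrix ι ι F[X]} {b : ι → Fin t}

/-- The diagonal blocks of a matrix of polynomials, at `X = 0`. -/
def constBlock (A : Matrix ι ι F[X]) (b : ι → Fin t) (τ : Fin t) :
    Matrix {i // b i = τ} {i // b i = τ} F := fun i j => (A i j).coeff 0

theorem pow_apply_eq_constBlock_pow (h0 : ∀ i j, b i < b j → A i j = 0)
    (h1 : ∀ i j, b i = b j → A i j = Polynomial.C ((A i j).coeff 0)) (τ : Fin t) (n : ℕ)
    (i j : {i // b i = τ}) :
    (A ^ n) i j = Polynomial.C ((constBlock A b τ ^ n) i j) := by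
  induction n generalizing i j with
  | zero =>
    rw [pow_zero, pow_zero, Matrix.one_apply, Matrix.one_apply]
    by_cases hij : i = j
    · simp [hij]
    · simp [hij, Subtype.ext_iff.not.1 hij]
  | succ n ih =>
    rw [pow_succ, pow_succ, Matrix.mul_apply, Matrix.mul_apply, map_sum]
    rw [← Finset.sum_filter_of_ne (p := fun l => b l = τ),
      Finset.sum_subtype (p := fun l => b l = τ) _ (by simp)]
    · refine Finset.sum_congr rfl fun l _ => ?_
      rw [ih, Polynomial.C_mul, h1 l j (l.2.trans j.2.symm)]
      rfl
    · intro l _ hl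
      rcases lt_trichotomy (b l) τ with hlt | heq | hlt
      · exact absurd (by rw [h0 l j (hlt.trans_eq j.2.symm), mul_zero]) hl
      · exact heq
      · exact absurd (by rw [blockTriangular_pow h0 n i l (i.2.trans_lt hlt), zero_mul]) hl

/-- The product of the block orders makes all diagonal blocks trivial, and `p^(t-1)` removes the
unipotent rest. `A ^ m = 1` ensures that the block orders are positive. -/
theorem exists_pow_eq_one_of_block [Fintype F] [Nonempty ι] (p : ℕ) [CharP F p]
    (hb : Function.Surjective b) (h0 : ∀ i j, b i < b j → A i j = 0)
    (h1 : ∀ i j, b i = b j → A i j = Polynomial.C ((A i j).coeff 0)) {m : ℕ} (hm : 0 < m)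
    (hA : A ^ m = 1) :
    ∃ n, 0 < n ∧ n ≤ (∏ τ : Fin t, (Fintype.card F ^ Fintype.card {i // b i = τ} - 1)) *
      p ^ (t - 1) ∧ A ^ n = 1 := by
  have hp : Fact p.Prime := ⟨CharP.char_is_prime F p⟩
  set D := constBlock A b with hD
  have hDm : ∀ τ, D τ ^ m = 1 := fun τ => by
    ext i j
    apply Polynomial.C_injective
    rw [← pow_apply_eq_constBlock_pow h0 h1, hA, Matrix.one_apply, Matrix.one_apply]
    by_cases hij : i = j
    · simp [hij]
    · simp [hij, Subtype.ext_iff.not.1 hij]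
  have hpos : ∀ τ, 0 < orderOf (D τ) := fun τ =>
    orderOf_pos_iff.2 (isOfFinOrder_iff_pow_eq_one.2 ⟨m, hm, hDm τ⟩)
  refine ⟨(∏ τ, orderOf (D τ)) * p ^ (t - 1),
    Nat.mul_pos (Finset.prod_pos fun τ _ => hpos τ) (pow_pos hp.out.pos _), ?_, ?_⟩
  · refine Nat.mul_le_mul_right _ (Finset.prod_le_prod' fun τ _ => ?_)
    have : Nonempty {i // b i = τ} := let ⟨i, hi⟩ := hb τ; ⟨⟨i, hi⟩⟩
    exact orderOf_matrix_le (D τ)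
  · rw [pow_mul]
    refine block_unipotent_pow_eq_one (b := b) p fun i j hij => ?_
    rcases hij.lt_or_eq with hlt | heq
    · rw [blockTriangular_pow h0 _ i j hlt, Matrix.one_apply_ne]
      rintro rfl
      exact lt_irrefl _ hlt
    · have h2 := pow_apply_eq_constBlock_pow h0 h1 (b j) (∏ τ, orderOf (D τ)) ⟨i, heq⟩ ⟨j, rfl⟩
      have h3 : D (b j) ^ ∏ τ, orderOf (D τ) = 1 :=
        orderOf_dvd_iff_pow_eq_one.1 (Finset.dvd_prod_of_mem _ (Finset.mem_univ _))
      rw [← hD, h3] at h2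
      refine h2.trans ?_
      rw [Matrix.one_apply, Matrix.one_apply]
      by_cases hij : i = j
      · subst hij; simp
      · simp [hij]

end BlockTriangular

end MatrixOrder

/-! ### Numerical consequences of the packet splitting -/

section PacketSplitting

variable {F : Type*} [Field F] [Fintype F] {r t : ℕ} {lam : Fin r → CInfty F}
  {B : Fin t → Finset (Fin r)}

theorem IsPacketSplitting.exists_index (h : IsPacketSplitting lam B) :
    ∃ b : Fin r → Fin t, ∀ i τ, i ∈ B τ ↔ b i = τ := by
  choose b hb using h.exists_mem
  refine ⟨b, fun i τ => ⟨fun hi => ?_, fun hi => hi ▸ hb i⟩⟩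
  rcases lt_trichotomy (b i) τ with hlt | heq | hlt
  · exact absurd (h.norm_lt _ _ hlt i (hb i) i hi) (lt_irrefl _)
  · exact heq
  · exact absurd (h.norm_lt _ _ hlt i hi i (hb i)) (lt_irrefl _)

theorem card_subtype_index {b : Fin r → Fin t} (hb : ∀ i τ, i ∈ B τ ↔ b i = τ) (τ : Fin t) :
    Fintype.card {i // b i = τ} = (B τ).card := by
  rw [Fintype.card_subtype]
  congr 1
  ext i
  simp [hb]

theorem IsPacketSplitting.sum_card (h : IsPacketSplitting lam B) : ∑ τ, (B τ).card = r := by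
  obtain ⟨b, hb⟩ := h.exists_index
  have := Finset.card_eq_sum_card_fiberwise (f := b) (s := Finset.univ) (t := Finset.univ)
    (fun _ _ => Finset.mem_coe.2 (Finset.mem_univ _))
  rw [Finset.card_univ, Fintype.card_fin] at this
  refine Eq.trans ?_ this.symm
  refine Finset.sum_congr rfl fun τ _ => congrArg _ ?_
  ext i
  simp [hb]

theorem IsPacketSplitting.le_rank (h : IsPacketSplitting lam B) : t ≤ r := by
  rw [← h.sum_card]
  have := Finset.sum_le_sum fun (τ : Fin t) (_ : τ ∈ Finset.univ) =>
    Nat.succ_le_of_lt (Finset.card_pos.2 (h.nonempty τ))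
  simpa using this

theorem prod_sub_one_le {ι : Type*} {s : Finset ι} (hs : s.Nonempty) {a : ι → ℕ}
    (ha : ∀ i ∈ s, 1 ≤ a i) : ∏ i ∈ s, (a i - 1) ≤ ∏ i ∈ s, a i - 1 := by
  induction hs using Finset.Nonempty.cons_induction with
  | singleton i => simp
  | cons i s hi hs ih =>
    rw [Finset.prod_cons, Finset.prod_cons]
    have h1 := ih fun j hj => ha j (Finset.mem_cons_of_mem hj)
    have h2 := ha i (Finset.mem_cons_self i s)
    have h3 : 1 ≤ ∏ j ∈ s, a j := Finset.one_le_prod' fun j hj => ha j (Finset.mem_cons_of_mem hj)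
    refine (Nat.mul_le_mul_left _ h1).trans ?_
    obtain ⟨c, hc⟩ := Nat.exists_eq_add_of_le h2
    obtain ⟨d, hd⟩ := Nat.exists_eq_add_of_le h3
    rw [hc, hd]
    simp only [Nat.add_sub_cancel_left]
    have : (1 + c) * (1 + d) = 1 + (c * d + c + d) := by ring
    omega

theorem IsPacketSplitting.prod_le (h : IsPacketSplitting lam B) (hr : 0 < r) :
    ∏ τ : Fin t, (Fintype.card F ^ (B τ).card - 1) ≤ Fintype.card F ^ r - 1 := by
  obtain ⟨τ, -⟩ := h.exists_mem ⟨0, hr⟩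
  refine (prod_sub_one_le ⟨τ, Finset.mem_univ τ⟩ fun _ _ =>
    Nat.one_le_pow _ _ Fintype.card_pos).trans ?_
  rw [Finset.prod_pow_eq_pow_sum, h.sum_card]

end PacketSplitting

/-! ### The order of a Galois automorphism on the lattice -/

section Order

variable {F : Type*} [Field F] [Fintype F] {L : IntermediateField (KInfty F) (CInfty F)}

theorem algEquiv_pow_smul_eq {M : IntermediateField L (CInfty F)} {ι : Type*} [Fintype ι]
    [DecidableEq ι] {y : ι → M} {A : Matrix ι ι F[X]} {σ : M ≃ₐ[L] M}
    (h : ∀ i, (σ (y i) : CInfty F) = ∑ j, A i j • (y j : CInfty F)) (n : ℕ) (i : ι) :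
    ((σ ^ n) (y i) : CInfty F) = ∑ j, (A ^ n) i j • (y j : CInfty F) := by
  induction n generalizing i with
  | zero => simp [Matrix.one_apply]
  | succ n ih =>
    rw [pow_succ', AlgEquiv.mul_apply, algEquiv_eq_sum_smul σ (ih i)]
    simp only [h, Finset.smul_sum, smul_smul, pow_succ, Matrix.mul_apply, Finset.sum_smul]
    exact Finset.sum_comm

theorem exists_pow_fixing_lattice [FiniteDimensional (KInfty F) L] {r t : ℕ} [NeZero r]
    {Λ : Submodule F[X] (CInfty F)} {lam : Fin r → CInfty F} {B : Fin t → Finset (Fin r)}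
    (p : ℕ) [CharP F p] (hΛ : IsLattice r Λ) (hlam : IsSuccessiveMinimumBasis Λ lam)
    (hB : IsPacketSplitting lam B) {M : IntermediateField L (CInfty F)} [FiniteDimensional L M]
    (hΛM : (Λ : Set (CInfty F)) ⊆ M) {σ : M ≃ₐ[L] M}
    (hσ : ∀ x : M, (x : CInfty F) ∈ Λ → (σ x : CInfty F) ∈ Λ) :
    ∃ n, 0 < n ∧ n ≤ (∏ τ : Fin t, (Fintype.card F ^ (B τ).card - 1)) * p ^ (t - 1) ∧
      ∀ x : M, (x : CInfty F) ∈ Λ → (σ ^ n) x = x := by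
  have hq := one_lt_card_real (F := F)
  obtain ⟨b, hb⟩ := hB.exists_index
  let y : Fin r → M := fun i => ⟨lam i, hΛM (hlam.mem i)⟩
  obtain ⟨A, hA⟩ : ∃ A : Matrix (Fin r) (Fin r) F[X],
      ∀ i, (σ (y i) : CInfty F) = ∑ j, A i j • lam j := by
    choose A hA using fun i => hlam.exists_eq_sum hΛ (hσ (y i) (hlam.mem i))
    exact ⟨A, hA⟩
  -- Orthogonality and the isometry property together. Entries towards a longer packet must vanish,
  -- and entries within a packet must have degree 0.
  have hnorm : ∀ i j, ‖A i j • lam j‖ ≤ ‖lam i‖ := fun i j => by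
    refine (hlam.norm_smul_le_norm_sum (A i) j).trans_eq ?_
    rw [← hA, norm_algEquiv]
  have hlt : ∀ i j, b i < b j → A i j = 0 := fun i j hij => by
    by_contra hne
    have h1 := hnorm i j
    rw [norm_polynomial_smul_of_ne_zero hne] at h1
    have h2 := hB.norm_lt _ _ hij i ((hb i _).2 rfl) j ((hb j _).2 rfl)
    have h3 := le_mul_of_one_le_left (norm_nonneg (lam j))
      (one_le_pow₀ hq.le (n := (A i j).natDegree))
    linarith
  have heq : ∀ i j, b i = b j → A i j = Polynomial.C ((A i j).coeff 0) := fun i j hij => by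
    by_cases hne : A i j = 0
    · simp [hne]
    refine Polynomial.eq_C_of_natDegree_eq_zero ?_
    have h1 := hnorm i j
    rw [norm_polynomial_smul_of_ne_zero hne,
      hB.norm_eq (b j) i ((hb i _).2 hij) j ((hb j _).2 rfl)] at h1
    by_contra hdeg
    have h2 := lt_mul_of_one_lt_left (norm_pos_iff.2 (hlam.ne_zero j)) (one_lt_pow₀ hq hdeg)
    linarith
  have hsurj : Function.Surjective b := fun τ =>
    let ⟨i, hi⟩ := hB.nonempty τ; ⟨i, (hb i τ).1 hi⟩
  have hpow := algEquiv_pow_smul_eq (y := y) (A := A) hA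
  have hfin : IsOfFinOrder σ := isOfFinOrder_of_finite σ
  obtain ⟨m, hm, hσm⟩ := isOfFinOrder_iff_pow_eq_one.1 hfin
  have hAm : A ^ m = 1 := by
    refine Matrix.ext fun i j => ?_
    have h1 := hpow m i
    rw [hσm, AlgEquiv.one_apply] at h1
    have h2 : ∑ j, (A ^ m - 1) i j • lam j = 0 := by
      simp only [Matrix.sub_apply, sub_smul, Finset.sum_sub_distrib, Matrix.one_apply, ite_smul,
        one_smul, zero_smul, Finset.sum_ite_eq, Finset.mem_univ, if_true]
      exact sub_eq_zero.2 h1.symm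
    exact sub_eq_zero.1 (Fintype.linearIndependent_iff.1 hlam.linearIndependent _ h2 j)
  obtain ⟨n, hn0, hn, hAn⟩ := exists_pow_eq_one_of_block p hsurj hlt heq hm hAm
  simp only [card_subtype_index hb] at hn
  refine ⟨n, hn0, hn, fun x hx => ?_⟩
  obtain ⟨a, ha⟩ := hlam.exists_eq_sum hΛ hx
  apply Subtype.ext
  rw [algEquiv_eq_sum_smul (y := y) (σ ^ n) ha, ha]
  refine Finset.sum_congr rfl fun i _ => ?_
  rw [hpow, hAn]
  simp [Matrix.one_apply, y]

end Order

/-! ### Residue degrees from powers of Frobenius -/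

section ResidueDegree

variable {F : Type*} [Field F] [Fintype F]

/-- A generator of the cyclic group `k'ˣ` has order `|k'| - 1`, which then divides `|k|^n - 1`. -/
theorem finrank_le_of_pow_card_pow_eq {k k' : Type*} [Field k] [Field k'] [Algebra k k']
    [Finite k'] {n : ℕ} (hn : 0 < n) (h : ∀ x : k', x ^ Nat.card k ^ n = x) :
    Module.finrank k k' ≤ n := by
  have : Finite k := Finite.of_injective _ (algebraMap k k').injective
  have : Module.Finite k k' := Module.Finite.of_finite
  have hQ : 1 < Nat.card k := Finite.one_lt_card
  have hcard : Nat.card k' ≤ Nat.card k ^ n := by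
    obtain ⟨g, hg⟩ := IsCyclic.exists_generator (α := k'ˣ)
    have hQn : 1 < Nat.card k ^ n := Nat.one_lt_pow hn.ne' hQ
    have h1 : g ^ (Nat.card k ^ n - 1) = 1 := by
      have h2 : g ^ (Nat.card k ^ n - 1) * g = g := by
        rw [← pow_succ, Nat.sub_add_cancel hQn.le]
        exact Units.ext (h g)
      exact mul_eq_right.1 h2
    have h2 := Nat.le_of_dvd (by omega) (orderOf_dvd_of_pow_eq_one h1)
    rw [orderOf_eq_card_of_forall_mem_zpowers hg, Nat.card_units] at h2
    omega
  rw [Module.natCard_eq_pow_finrank (K := k) (V := k')] at hcard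
  exact (Nat.pow_le_pow_iff_right hQ).1 hcard

theorem residueDegree_le {E E' : Type*} [Field E] [Field E'] [Algebra E E']
    [Algebra E (CInfty F)] [Algebra E' (CInfty F)] [IsScalarTower E E' (CInfty F)]
    [Finite (IsLocalRing.ResidueField (valuationRing F E'))] {n : ℕ} (hn : 0 < n)
    (h : ∀ x : E', ‖algebraMap E' (CInfty F) x‖ ≤ 1 → ‖algebraMap E' (CInfty F)
      (x ^ Nat.card (IsLocalRing.ResidueField (valuationRing F E)) ^ n - x)‖ < 1) :
    residueDegree F E E' ≤ n := by
  let := valuationRingAlgebra F E E'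
  let m := IsLocalRing.maximalIdeal (valuationRing F E)
  let m' := IsLocalRing.maximalIdeal (valuationRing F E')
  have hover : m'.LiesOver m := ⟨by
    ext x
    rw [Ideal.mem_comap, ← IsLocalRing.residue_eq_zero_iff, ← IsLocalRing.residue_eq_zero_iff,
      residue_eq_zero_iff, residue_eq_zero_iff, IsScalarTower.algebraMap_apply E E' (CInfty F)]
    rfl⟩
  have hdeg : residueDegree F E E' = Module.finrank (valuationRing F E ⧸ m)
      (valuationRing F E' ⧸ m') := Ideal.inertiaDeg_eq_of_isMaximal m m'
  rw [hdeg]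
  let : Field (valuationRing F E ⧸ m) := Ideal.Quotient.field m
  let : Field (valuationRing F E' ⧸ m') := Ideal.Quotient.field m'
  have : Finite (valuationRing F E' ⧸ m') := ‹Finite (IsLocalRing.ResidueField _)›
  refine finrank_le_of_pow_card_pow_eq hn fun x => ?_
  obtain ⟨y, rfl⟩ := Ideal.Quotient.mk_surjective x
  rw [← sub_eq_zero, ← map_pow, ← map_sub]
  exact (residue_eq_zero_iff _).2 (h y ((mem_valuationRing F _).1 y.2))

end ResidueDegree

/-! ### Lifting Frobenius to the Galois group -/

section FrobeniusLift

variable {F : Type*} [Field F] [Fintype F] {L : IntermediateField (KInfty F) (CInfty F)}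
  [FiniteDimensional (KInfty F) L]

theorem norm_pow_card_residueField_sub_lt (c : L) (hc : ‖(c : CInfty F)‖ ≤ 1) :
    ‖(c : CInfty F) ^ Nat.card (IsLocalRing.ResidueField (valuationRing F L)) - c‖ < 1 := by
  have : Finite (IsLocalRing.ResidueField (valuationRing F L)) := finite_residueField
  let : Fintype (IsLocalRing.ResidueField (valuationRing F L)) := Fintype.ofFinite _
  let c' : valuationRing F L := ⟨c, hc⟩
  have h1 : IsLocalRing.residue _ (c' ^ Nat.card (IsLocalRing.ResidueField (valuationRing F L)) -
      c') = 0 := by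
    rw [map_sub, map_pow, Nat.card_eq_fintype_card, FiniteField.pow_card, sub_self]
  exact (residue_eq_zero_iff _).1 h1

variable (L) in
theorem exists_card_residueField_eq (p : ℕ) [CharP F p] :
    ∃ e, Nat.card (IsLocalRing.ResidueField (valuationRing F L)) = p ^ e := by
  have : Finite (IsLocalRing.ResidueField (valuationRing F L)) := finite_residueField
  let : Fintype (IsLocalRing.ResidueField (valuationRing F L)) := Fintype.ofFinite _
  have : CharP (IsLocalRing.ResidueField (valuationRing F L)) p :=
    (RingHom.charP_iff_charP ((IsLocalRing.residue _).comp (constHom F L)) p).1 ‹_›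
  obtain ⟨e, -, he⟩ := FiniteField.card (IsLocalRing.ResidueField (valuationRing F L)) p
  exact ⟨e, by rw [Nat.card_eq_fintype_card, he]⟩

/-- The polynomial `∏ (X - σ a)` has integral coefficients in `L`, whose residues are fixed by the
`Q`-th power. Hence its value at `a^Q` is congruent to the `Q`-th power of its value at `a`, which
is 0, and some factor `a^Q - σ a` must be small. -/
theorem exists_norm_algEquiv_sub_pow_lt (p : ℕ) [CharP F p] {M : IntermediateField L (CInfty F)}
    [FiniteDimensional L M] [IsGalois L M] (a : M) (ha : ‖(a : CInfty F)‖ ≤ 1) :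
    ∃ σ : M ≃ₐ[L] M, ‖(a : CInfty F) ^
      Nat.card (IsLocalRing.ResidueField (valuationRing F L)) - σ a‖ < 1 := by
  obtain ⟨e, he⟩ := exists_card_residueField_eq L p
  set Q := Nat.card (IsLocalRing.ResidueField (valuationRing F L)) with hQ
  have hp : Fact p.Prime := ⟨CharP.char_is_prime F p⟩
  have : CharP (CInfty F) p :=
    (RingHom.charP_iff_charP ((algebraMap F[X] (CInfty F)).comp Polynomial.C) p).1 ‹_›
  let P : Polynomial M := ∏ σ : M ≃ₐ[L] M, (Polynomial.X - Polynomial.C (σ a))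
  have hPL : ∀ i, ∃ c : L, algebraMap L M c = P.coeff i := fun i => by
    refine (IsGalois.mem_range_algebraMap_iff_fixed (F := L) (E := M) _).2 fun τ => ?_
    have hPτ : P.map (τ : M →+* M) = P := by
      simp only [P, Polynomial.map_prod, Polynomial.map_sub, Polynomial.map_X, Polynomial.map_C]
      exact Fintype.prod_equiv (Equiv.mulLeft τ) _ _ fun σ => rfl
    conv_rhs => rw [← hPτ, Polynomial.coeff_map]
    rfl
  have hPO : ∀ i, ‖(P.coeff i : CInfty F)‖ ≤ 1 := fun i => by
    let P' : Polynomial (valuationRing F M) := ∏ σ : M ≃ₐ[L] M, (Polynomial.X - Polynomial.C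
      ⟨σ a, (mem_valuationRing F _).2 ((norm_algEquiv M σ a).trans_le ha)⟩)
    have hP' : P'.map (valuationRing F M).subtype = P := by
      simp [P, P', Polynomial.map_prod]
    rw [← hP', Polynomial.coeff_map]
    exact (mem_valuationRing F _).1 (P'.coeff i).2
  choose c hc using hPL
  have hcC : ∀ i, (P.coeff i : CInfty F) = c i := fun i => by rw [← hc]; rfl
  have hroot : ∑ i ∈ Finset.range (P.natDegree + 1), (c i : CInfty F) * (a : CInfty F) ^ i = 0 := by
    have h0 : P.eval a = 0 := by
      rw [Polynomial.eval_prod]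
      exact Finset.prod_eq_zero (Finset.mem_univ 1) (by simp)
    rw [Polynomial.eval_eq_sum_range] at h0
    have := congrArg (algebraMap M (CInfty F)) h0
    rw [map_sum, map_zero] at this
    simp only [map_mul, map_pow, IntermediateField.algebraMap_apply, hcC] at this
    exact this
  have hevalQ : ∏ σ : M ≃ₐ[L] M, ((a : CInfty F) ^ Q - σ a) =
      ∑ i ∈ Finset.range (P.natDegree + 1), (c i : CInfty F) * ((a : CInfty F) ^ Q) ^ i := by
    have h0 : P.eval (a ^ Q) = ∏ σ : M ≃ₐ[L] M, (a ^ Q - σ a) := by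
      simp [P, Polynomial.eval_prod]
    rw [Polynomial.eval_eq_sum_range] at h0
    have := congrArg (algebraMap M (CInfty F)) h0
    rw [map_sum, map_prod] at this
    simp only [map_mul, map_pow, map_sub, IntermediateField.algebraMap_apply, hcC] at this
    exact this.symm
  have hlt : ‖∏ σ : M ≃ₐ[L] M, ((a : CInfty F) ^ Q - σ a)‖ < 1 := by
    have h1 := congrArg (· ^ Q) hroot
    simp only [he] at h1
    rw [sum_pow_char_pow, zero_pow (pow_ne_zero _ hp.out.ne_zero), ← he] at h1
    rw [hevalQ, ← sub_zero (∑ i ∈ _, _), ← h1, ← Finset.sum_sub_distrib]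
    refine norm_sum_lt_of_forall_lt one_pos fun i _ => ?_
    rw [mul_pow, ← pow_mul, ← pow_mul, mul_comm Q i, ← sub_mul, norm_mul, norm_sub_rev]
    refine mul_lt_one_of_nonneg_of_lt_one_left (norm_nonneg _)
      (norm_pow_card_residueField_sub_lt (c i) (by rw [← hcC]; exact hPO i)) ?_
    rw [norm_pow]
    exact pow_le_one₀ (norm_nonneg _) ha
  by_contra! hge
  rw [norm_prod] at hlt
  have hle := Finset.prod_le_prod (s := Finset.univ) (fun _ _ => zero_le_one)
    fun σ (_ : σ ∈ Finset.univ) => hge σ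
  rw [Finset.prod_const_one] at hle
  exact hlt.not_ge hle

/-- The Frobenius automorphism of the residue field extension lifts to the Galois group. -/
theorem exists_frobenius_lift (p : ℕ) [CharP F p] (M : IntermediateField L (CInfty F))
    [FiniteDimensional L M] [IsGalois L M] :
    ∃ σ : M ≃ₐ[L] M, ∀ x : M, ‖(x : CInfty F)‖ ≤ 1 → ‖(σ x : CInfty F) - (x : CInfty F) ^
      Nat.card (IsLocalRing.ResidueField (valuationRing F L))‖ < 1 := by
  set Q := Nat.card (IsLocalRing.ResidueField (valuationRing F L)) with hQ
  have : FiniteDimensional (KInfty F) M := FiniteDimensional.trans (KInfty F) L M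
  have : IsScalarTower (KInfty F) M (CInfty F) := IsScalarTower.of_algebraMap_eq fun _ => rfl
  let k := IsLocalRing.ResidueField (valuationRing F M)
  have : Finite k := finite_residueField
  have hQ0 : Q ≠ 0 := by
    have : Finite (IsLocalRing.ResidueField (valuationRing F L)) := finite_residueField
    exact Nat.card_pos.ne'
  -- A `σ` that acts as Frobenius on a lift of a generator acts so on every residue, since each
  -- nonzero residue is a power of the generator.
  obtain ⟨g, hg⟩ := IsCyclic.exists_generator (α := kˣ)
  obtain ⟨a, ha⟩ := IsLocalRing.residue_surjective (g : k)
  obtain ⟨σ, hσ⟩ := exists_norm_algEquiv_sub_pow_lt p (a : M) ((mem_valuationRing F _).1 a.2)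
  refine ⟨σ, fun x hx => ?_⟩
  let s : valuationRing F M →+* valuationRing F M :=
    (σ : M →+* M).restrict _ _ fun y hy => by
      rw [mem_valuationRing] at hy ⊢
      exact (norm_algEquiv M σ y).trans_le hy
  have hs : ∀ y, IsLocalRing.residue _ y = (0 : k) → IsLocalRing.residue _ (s y) = (0 : k) :=
    fun y hy => by
      rw [residue_eq_zero_iff] at hy ⊢
      exact (norm_algEquiv M σ y).trans_lt hy
  have hsa : IsLocalRing.residue _ (s a) = (g : k) ^ Q := by
    rw [← ha, ← map_pow, eq_comm, ← sub_eq_zero, ← map_sub, residue_eq_zero_iff]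
    exact hσ
  let x' : valuationRing F M := ⟨x, hx⟩
  have hsx : IsLocalRing.residue _ (s x') = (IsLocalRing.residue _ x' : k) ^ Q := by
    by_cases h0 : IsLocalRing.residue _ x' = (0 : k)
    · rw [hs _ h0, h0, zero_pow hQ0]
    · obtain ⟨n, hn⟩ := (mem_powers_iff_mem_zpowers.2 (hg (Units.mk0 _ h0)) :)
      have hn' : (g : k) ^ n = IsLocalRing.residue _ x' := congrArg Units.val hn
      have h1 : IsLocalRing.residue _ (s (x' - a ^ n)) = (0 : k) := hs _ (by
        rw [map_sub, map_pow, ha, hn', sub_self])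
      rw [map_sub, map_sub, map_pow, map_pow, hsa, sub_eq_zero] at h1
      rw [h1, ← hn', ← pow_mul, ← pow_mul, mul_comm]
  rw [← map_pow, ← sub_eq_zero, ← map_sub, residue_eq_zero_iff] at hsx
  exact hsx

theorem norm_algEquiv_pow_sub_pow_lt {M : IntermediateField L (CInfty F)} [FiniteDimensional L M]
    {σ : M ≃ₐ[L] M} {Q : ℕ}
    (hσ : ∀ x : M, ‖(x : CInfty F)‖ ≤ 1 → ‖(σ x : CInfty F) - (x : CInfty F) ^ Q‖ < 1)
    {x : M} (hx : ‖(x : CInfty F)‖ ≤ 1) (n : ℕ) :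
    ‖((σ ^ n) x : CInfty F) - (x : CInfty F) ^ Q ^ n‖ < 1 := by
  induction n with
  | zero => simp
  | succ n ih =>
    have h1 : ‖((σ ((σ ^ n) x - x ^ Q ^ n) : M) : CInfty F)‖ < 1 := by
      rw [norm_algEquiv]; exact ih
    have h2 := hσ (x ^ Q ^ n) (by
      rw [IntermediateField.coe_pow, norm_pow]; exact pow_le_one₀ (norm_nonneg _) hx)
    have h3 : ((σ ^ (n + 1)) x : CInfty F) - (x : CInfty F) ^ Q ^ (n + 1) =
        (σ ((σ ^ n) x - x ^ Q ^ n) : M) +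
          ((σ (x ^ Q ^ n) : CInfty F) - ((x ^ Q ^ n : M) : CInfty F) ^ Q) := by
      rw [map_sub, pow_succ' σ, AlgEquiv.mul_apply, pow_succ Q, pow_mul]
      push_cast
      ring
    rw [h3]
    exact (IsUltrametricDist.norm_add_le_max _ _).trans_lt (max_lt h1 h2)

end FrobeniusLift

/-! ### The bound for `L(Λ)` -/

section Main

variable {F : Type*} [Field F] [Fintype F]

theorem finiteDimensional_and_residueDegree_periodField_le (p : ℕ) [CharP F p]
    (L : IntermediateField (KInfty F) (CInfty F)) [FiniteDimensional (KInfty F) L]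
    {r : ℕ} [NeZero r] {φ : DrinfeldModule L r} {Λ : Submodule F[X] (CInfty F)}
    (hΛ : IsPeriodLattice φ Λ) {lam : Fin r → CInfty F} (hlam : IsSuccessiveMinimumBasis Λ lam)
    {t : ℕ} {B : Fin t → Finset (Fin r)} (hB : IsPacketSplitting lam B) :
    FiniteDimensional L (periodField L Λ) ∧ residueDegree F L (periodField L Λ) ≤
      (∏ τ : Fin t, (Fintype.card F ^ (B τ).card - 1)) * p ^ (t - 1) := by
  obtain ⟨M, hMfin, hMgal, hΛM, hMΛ⟩ := exists_isGalois_lattice_subset hΛ hlam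
  have hle : periodField L Λ ≤ M := IntermediateField.adjoin_le_iff.2 hΛM
  have hfin : FiniteDimensional L (periodField L Λ) :=
    FiniteDimensional.of_injective (IntermediateField.inclusion hle).toLinearMap
      (IntermediateField.inclusion hle).injective
  refine ⟨hfin, ?_⟩
  have : FiniteDimensional (KInfty F) (periodField L Λ) :=
    FiniteDimensional.trans (KInfty F) L (periodField L Λ)
  have : IsScalarTower (KInfty F) (periodField L Λ) (CInfty F) :=
    IsScalarTower.of_algebraMap_eq fun _ => rfl
  have := finite_residueField (F := F) (E := periodField L Λ)
  obtain ⟨σ, hσ⟩ := exists_frobenius_lift p M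
  obtain ⟨n, hn0, hn, hfix⟩ := exists_pow_fixing_lattice p hΛ.isLattice hlam hB hΛM (hMΛ σ)
  refine (residueDegree_le hn0 fun x hx => ?_).trans hn
  -- `Λ` generates the field over `L`, so fixing `Λ` suffices. Only the restriction of `σ^n` to
  -- `L(Λ)` matters; the residue degree of `M` plays no role.
  have hfixed : ∀ y : periodField L Λ,
      (σ ^ n) (IntermediateField.inclusion hle y) = IntermediateField.inclusion hle y := by
    have heq : ((σ ^ n : M ≃ₐ[L] M) : M →ₐ[L] M).comp (IntermediateField.inclusion hle) =
        IntermediateField.inclusion hle := by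
      refine IntermediateField.algHom_ext_of_eq_adjoin _ rfl fun y hy => ?_
      exact hfix ⟨y, hΛM hy⟩ hy
    exact fun y => DFunLike.congr_fun heq y
  have h1 := norm_algEquiv_pow_sub_pow_lt hσ (x := IntermediateField.inclusion hle x) hx n
  rw [hfixed, norm_sub_rev] at h1
  exact h1

end Main

end DrinfeldPeriods

end

theorem theorem4 {F : Type*} [Field F] [Fintype F] (p : ℕ) [CharP F p]
    (L : IntermediateField (DrinfeldPeriods.KInfty F) (DrinfeldPeriods.CInfty F))
    [FiniteDimensional (DrinfeldPeriods.KInfty F) L]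
    (r : ℕ) (hr : 2 ≤ r) (φ : DrinfeldPeriods.DrinfeldModule L r)
    (Λ : Submodule (Polynomial F) (DrinfeldPeriods.CInfty F))
    (hΛ : DrinfeldPeriods.IsPeriodLattice φ Λ)
    (lam : Fin r → DrinfeldPeriods.CInfty F)
    (hlam : DrinfeldPeriods.IsSuccessiveMinimumBasis Λ lam)
    (t : ℕ) (B : Fin t → Finset (Fin r)) (hB : DrinfeldPeriods.IsPacketSplitting lam B) :
    FiniteDimensional L (DrinfeldPeriods.periodField L Λ) ∧
    DrinfeldPeriods.residueDegree F L (DrinfeldPeriods.periodField L Λ) ≤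
      (∏ τ : Fin t, (Fintype.card F ^ (B τ).card - 1)) * p ^ (t - 1) ∧
    DrinfeldPeriods.residueDegree F L (DrinfeldPeriods.periodField L Λ) ≤
      (Fintype.card F ^ r - 1) * p ^ (t - 1) ∧
    DrinfeldPeriods.residueDegree F L (DrinfeldPeriods.periodField L Λ) ≤
      (Fintype.card F ^ r - 1) * p ^ (r - 1) := by
  have : NeZero r := ⟨by omega⟩
  obtain ⟨hfin, hle⟩ :=
    DrinfeldPeriods.finiteDimensional_and_residueDegree_periodField_le p L hΛ hlam hB
  have hprod := hB.prod_le (F := F) (by omega)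
  have hp : 0 < p := (CharP.char_is_prime F p).pos
  have hr' := hle.trans (Nat.mul_le_mul_right (p ^ (t - 1)) hprod)
  have ht : t - 1 ≤ r - 1 := Nat.sub_le_sub_right hB.le_rank 1
  exact ⟨hfin, hle, hr', hr'.trans (Nat.mul_le_mul_left _ (Nat.pow_le_pow_right hp ht))⟩
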